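/- Consider the $3\times 3$ MIMO X-multicast channel: three transmitters with $M\ge 1$ antennas each, three receivers with $N\ge 1$ antennas each, and nine independent messages, one from each transmitter for each set of two receivers, which both have to decode it. In channel use $t$ receiver $j$ observes ${\bf y}_j(t)=\sum_{p=1}^3{\bf H}_{jp}{\bf x}_p(t)+{\bf n}_j(t)\in\mathbb{C}^N$, where ${\bf n}_j$ is white complex Gaussian noise of unit variance, $\|{\bf x}_p(t)\|^2\le P$, the entries of all matrices ${\bf H}_{jp}\in\mathbb{C}^{N\times M}$ are drawn i.i.d. from a distribution on $\mathbb{C}$ with a density, stay constant during the transmission, and are known to all nodes. A number $d$ of degrees of freedom (DoF) per user is achievable over ${\bf H}$ if, with vanishing error probability as the block length grows, nine messages of equal rate can be sent such that the total rate of the six messages desired by a receiver is $d\log P+o(\log P)$ as $P\to\infty$. Then for almost every channel realization the DoF per user $$d_{11}=\begin{cases}\frac{6N}{7}, & \frac NM\in(0,1],\\ \frac{6M}{7}, & \frac NM\in(1,\frac97],\\ \frac{2N}{3}, & \frac NM\in(\frac97,3],\\ 2M, & \frac NM\in(3,\infty)\end{cases}$$ is achievable. Moreover, the value $d_{11}$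 is attained by linear schemes with finite symbol extensions, in which each message is carried by $s$ linearly precoded data streams over $t$ channel uses, every receiver (possibly using only some of its antennas) recovers all desired streams by linear combining matrices that null all other signals, and $6s/t=d_{11}$; here $s$ and $t$ depend only on $M$ and $N$, and the scheme exists for almost every channel realization: (a) if $\frac NM\le\frac97$ and $(M,N)\ne(1,1)$, by interference alignment: at each receiver the three undesired signals are received through one common matrix; (b) if $\frac NM>\frac97$, by alternating transmission with zero-forcing receive combining: there are three phases of equal length; in each phase every transmitter sends only its message for one receive group, different transmitters serve different groups, and each transmitter serves a different group in each phase. -/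

import Mathlib

open MeasureTheory ProbabilityTheory Filter Topology
open scoped Kronecker

noncomputable section

namespace XMulticast

/-! ### The channel -/

/-- A receive multicast group: a set of two of the three receivers. -/
abbrev RxGroup : Type := {S : Finset (Fin 3) // S.card = 2}

/-- A channel realization of the 3 × 3 MIMO channel with `M` antennas at each transmitter and `N`
antennas at each receiver: `H (j, p, n, m)` is the complex gain from antenna `m` of transmitter `p`
to antenna `n` of receiver `j`.  It stays constant during a transmission. -/
abbrev Channel (M N : ℕ) : Type := Fin 3 × Fin 3 × Fin N × Fin M → ℂ

/-- The `N × M` channel matrix from transmitter `p` to receiver `j`. -/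
def link {M N : ℕ} (H : Channel M N) (j p : Fin 3) : Matrix (Fin N) (Fin M) ℂ :=
  Matrix.of fun n m => H (j, p, n, m)

/-- The law of the channel: all entries are i.i.d. with law `ν`. -/
def channelLaw (M N : ℕ) (ν : Measure ℂ) : Measure (Channel M N) :=
  Measure.pi fun _ => ν

/-- The property `Q` holds for almost every channel realization, whenever the channel entries are
i.i.d. with a continuous distribution (one that has a density). -/
def ForAlmostEveryChannel (M N : ℕ) (Q : Channel M N → Prop) : Prop :=
  ∀ ν : Measure ℂ, IsProbabilityMeasure ν → ν ≪ (volume : Measure ℂ) →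
    ∀ᵐ H ∂(channelLaw M N ν), Q H

/-- Circularly symmetric complex Gaussian law with mean zero and unit variance. -/
def complexGaussian : Measure ℂ :=
  ((gaussianReal 0 (1 / 2)).prod (gaussianReal 0 (1 / 2))).map Complex.measurableEquivRealProd.symm

/-- Law of the white Gaussian noise at one receiver (`N` antennas) during `T` channel uses. -/
def noise (T N : ℕ) : Measure (Fin T × Fin N → ℂ) :=
  Measure.pi fun _ => complexGaussian

/-! ### Codes for the X-multicast channel and degrees of freedom -/

/-- The messages: transmitter `p` has one message `w p S` of `B` bits for every receive multicast
group `S`. -/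
abbrev Messages (B : ℕ) : Type := Fin 3 → RxGroup → Fin (2 ^ B)

/-- A code of block length `T` with nine messages of `B` bits each.  Transmitter `p` encodes its own
three messages only; receiver `j` estimates, from its received signal, the messages of all
transmitters for the groups that contain `j`.  (Codes are chosen after the channel realization, so
encoders and decoders may depend on it.) -/
structure Code (M N T B : ℕ) where
  /-- encoder of transmitter `p` -/
  enc : (p : Fin 3) → (RxGroup → Fin (2 ^ B)) → Fin T → Fin M → ℂ
  /-- decoder of receiver `j` -/
  dec : (j : Fin 3) → (Fin T × Fin N → ℂ) → {S : RxGroup // j ∈ S.1} → Fin 3 → Fin (2 ^ B)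
  measurable_dec : ∀ j, Measurable (dec j)

namespace Code

variable {M N T B : ℕ}

/-- Power constraint: each transmitted vector `x` satisfies `tr (x xᴴ) ≤ P`. -/
def PowerLE (c : Code M N T B) (P : ℝ) : Prop :=
  ∀ p w τ, ∑ m, ‖c.enc p w τ m‖ ^ 2 ≤ P

/-- Received signal at receiver `j` when the messages are `w` and the noise is `z`. -/
def received (c : Code M N T B) (H : Channel M N) (j : Fin 3) (w : Messages B)
    (z : Fin T × Fin N → ℂ) : Fin T × Fin N → ℂ :=
  fun i => (∑ p, (link H j p).mulVec (c.enc p (w p) i.1) i.2) + z i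

/-- Probability that receiver `j` gets one of its desired messages wrong, the messages being
independent and uniformly distributed and independent of the noise. -/
def errorProb (c : Code M N T B) (H : Channel M N) (j : Fin 3) : ℝ :=
  (∑ w : Messages B,
      (noise T N).real {z | ∃ (S : {S : RxGroup // j ∈ S.1}) (p : Fin 3),
        c.dec j (c.received H j w z) S p ≠ w p S.1}) /
    Fintype.card (Messages B)

end Code

/-- The per-user rate `R` (bits per channel use) is achievable at power `P` over the channel `H`.
Every receiver desires six messages (two groups, three transmitters), so that `B` bits per message
amount to `6 * B` desired bits per user. -/
def AchievableRate {M N : ℕ} (H : Channel M N) (P R : ℝ) : Prop :=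
  ∀ ε : ℝ, 0 < ε → ∀ᶠ T : ℕ in atTop, ∃ (B : ℕ) (c : Code M N T B),
    R * T ≤ 6 * B ∧ c.PowerLE P ∧ ∀ j, c.errorProb H j ≤ ε

/-- `d` degrees of freedom per user are achievable over the channel `H`: per-user rates
`d * log P + o(log P)` are achievable as `P → ∞`. -/
def AchievableDoF {M N : ℕ} (H : Channel M N) (d : ℝ) : Prop :=
  ∃ R : ℝ → ℝ, (∀ᶠ P in atTop, AchievableRate H P (R P)) ∧
    Tendsto (fun P => R P / Real.logb 2 P) atTop (𝓝 d)

/-! ### Linear schemes with finite symbol extensions -/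

/-- A linear scheme over the channel uses `τ` (a symbol extension of length `card τ`) with `s` data
streams per message: `V S p` precodes the message of transmitter `p` for the group `S`, and
receiver `j` uses its antennas in `active j`, the others being deactivated.  (Transmit antennas are
deactivated by zero rows of `V S p`.) -/
structure LinearScheme (M N s : ℕ) (τ : Type) where
  active : Fin 3 → Finset (Fin N)
  V : RxGroup → Fin 3 → Matrix (τ × Fin M) (Fin s) ℂ

namespace LinearScheme

variable {M N s : ℕ} {τ : Type} [Fintype τ] [DecidableEq τ]

/-- The matrix through which receiver `j` sees, on its active antennas and over the whole symbol
extension, the data streams of the message of transmitter `p` for the group `S`. -/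
def seen (L : LinearScheme M N s τ) (H : Channel M N) (j : Fin 3) (S : RxGroup) (p : Fin 3) :
    Matrix (τ × {n // n ∈ L.active j}) (Fin s) ℂ :=
  ((1 : Matrix τ τ ℂ) ⊗ₖ (link H j p).submatrix
    (Subtype.val : {n // n ∈ L.active j} → Fin N) id) * L.V S p

/-- Every receiver recovers each of its desired messages by a linear receive combining matrix that
forces all other signals to zero. -/
def Decodable (L : LinearScheme M N s τ) (H : Channel M N) : Prop :=
  ∀ (j : Fin 3) (S : RxGroup), j ∈ S.1 → ∀ p : Fin 3,
    ∃ U : Matrix (Fin s) (τ × {n // n ∈ L.active j}) ℂ,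
      U * L.seen H j S p = 1 ∧
      ∀ (S' : RxGroup) (p' : Fin 3), (S', p') ≠ (S, p) → U * L.seen H j S' p' = 0

/-- Interference alignment: at every receiver the undesired signals of the three transmitters are
seen through one and the same matrix. -/
def Aligned (L : LinearScheme M N s τ) (H : Channel M N) : Prop :=
  ∀ (j : Fin 3) (S : RxGroup), j ∉ S.1 → ∀ p p' : Fin 3, L.seen H j S p = L.seen H j S p'

/-- Degrees of freedom per user: six desired messages of `s` streams in `card τ` channel uses. -/
def dof (_L : LinearScheme M N s τ) : ℝ := 6 * (s : ℝ) / (Fintype.card τ : ℝ)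

/-- Alternating transmission in three phases of `l` channel uses each: in phase `k` each
transmitter `p` sends only its message for the group `σ k p`, different transmitters serve different
groups, and each transmitter serves different groups in different phases. -/
def Alternating {l : ℕ} (L : LinearScheme M N s (Fin 3 × Fin l)) : Prop :=
  ∃ σ : Fin 3 → Fin 3 → RxGroup,
    (∀ k, Function.Injective (σ k)) ∧ (∀ p, Function.Injective fun k => σ k p) ∧
    ∀ (k : Fin 3) (i : Fin l) (p : Fin 3) (S : RxGroup), S ≠ σ k p →
      ∀ (m : Fin M) (c : Fin s), L.V S p ((k, i), m) c = 0

end LinearScheme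

/-- The degrees of freedom per user `d₁₁` as a function of the antenna numbers. -/
def d11 (M N : ℕ) : ℝ :=
  if (N : ℝ) / M ≤ 1 then 6 * N / 7
  else if (N : ℝ) / M ≤ 9 / 7 then 6 * M / 7
  else if (N : ℝ) / M ≤ 3 then 2 * N / 3
  else 2 * M

end XMulticast

end

/-! The four cases of `d11` are two formulas: `6 * min M N / 7` when `N / M ≤ 9 / 7`, and `2 * min
(3 * M) N / 3` otherwise. Each is attained by an explicit linear scheme that works off the zero set
of a polynomial in the channel. Such a zero set is null as soon as one point lies outside it
(`forAlmostEveryChannel_ne_zero`).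

For large `N / M`, let `K = min (3 * M) N`. Streams are sent uncoded so that in each slot exactly
`K` streams leave `K` different (transmitter, antenna) pairs. A receiver inverts a generic `K × K`
matrix and learns all of them (`exists_alternating_scheme`); nine channel uses carry `K` streams per
message.

For small `N / M`, let `K = min M N`. Over seven channel uses each message carries `K` streams. A
transmitter inverts its channel to the receiver that does not want the message, up to a determinant
factor that makes the three interfering signals coincide. These then fill `K` of the `7 * K`
received dimensions, leaving `6 * K` for the desired streams. What remains is that a square matrix
is generically invertible (`exists_aligned_scheme_of_points`). Since the channel is constant, this
rests on noncommuting link matrices, hence on `2 ≤ K` (`exists_square_point`). For one receive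
antenna and several transmit antennas, signals on beams invisible to the unintended receiver replace
noncommutativity (`exists_single_receive_antenna_point`).

With single antennas everywhere the alignment is arithmetic. Channel inversion makes the undesired
Gaussian integers add up to one Gaussian integer, and a Borel–Cantelli argument of
Khintchine–Groshev type separates the six desired symbols of size `Q` at distance about `Q ^ (-6)`
(`ae_eventually_notMem_nearGaussianInt`). Seven integers share one complex dimension, of which six
are desired.

Both kinds of schemes give integer constellations whose received minimum distance decays like `Q ^
(-κ)`: `κ = 0` for linear decoding, `κ = 6` for single antennas. A Gilbert–Varshamov outer code
corrects the rare symbol errors, so that the error probability vanishes at fixed power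
(`achievableRate_of_separated`). Choosing `Q` as a power of `P` gives `6 * s / (t * (1 + κ))`
degrees of freedom (`achievableDoF_of_minDistGE`). -/

noncomputable section

namespace XMulticast

/-! ### Product measures and polynomial functions -/

/-- A set is no larger than the largest of its sections along one coordinate. -/
theorem pi_measure_le_of_section {ι : Type*} [Fintype ι] [DecidableEq ι] {α : Type*}
    [MeasurableSpace α] (ν : Measure α) [IsProbabilityMeasure ν] {S : Set (ι → α)}
    (hS : MeasurableSet S) (i : ι) {c : ENNReal}
    (h : ∀ x : ι → α, ν {z | Function.update x i z ∈ S} ≤ c) :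
    Measure.pi (fun _ => ν) S ≤ c := by
  rcases isEmpty_or_nonempty (ι → α) with hE | ⟨⟨x0⟩⟩
  · rw [Set.eq_empty_of_isEmpty S]; simp
  have hm : Measurable (S.indicator (1 : (ι → α) → ENNReal)) := measurable_one.indicator hS
  calc Measure.pi (fun _ => ν) S = ∫⁻ x, S.indicator 1 x ∂(Measure.pi fun _ => ν) :=
        (lintegral_indicator_one hS).symm
    _ = (∫⋯∫⁻_Finset.univ, S.indicator 1 ∂(fun _ => ν)) x0 := lintegral_eq_lmarginal_univ x0
    _ = (∫⋯∫⁻_Finset.univ.erase i, (fun x => ∫⁻ z, S.indicator 1 (Function.update x i z) ∂ν)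
          ∂(fun _ => ν)) x0 := by
        rw [lmarginal_erase' _ hm (Finset.mem_univ i)]
    _ ≤ (∫⋯∫⁻_Finset.univ.erase i, (fun _ => c) ∂(fun _ => ν)) x0 := by
        refine lmarginal_mono (fun x => ?_) x0
        have : (fun z => S.indicator (1 : (ι → α) → ENNReal) (Function.update x i z)) =
            {z | Function.update x i z ∈ S}.indicator 1 := by
          ext z; simp [Set.indicator]
        simp only [this]
        exact (lintegral_indicator_one (measurable_update x hS)).trans_le (h x)
    _ ≤ c := by
        simp [lmarginal]

/-- The algebra of polynomial functions of the coordinates of `ι → ℂ`. -/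
def PolyFun (ι : Type*) : Subalgebra ℂ ((ι → ℂ) → ℂ) :=
  Algebra.adjoin ℂ (Set.range fun (i : ι) (x : ι → ℂ) => x i)

namespace PolyFun

variable {ι : Type*}

theorem coord (i : ι) : (fun x : ι → ℂ => x i) ∈ PolyFun ι :=
  Algebra.subset_adjoin ⟨i, rfl⟩

theorem const (c : ℂ) : (fun _ : ι → ℂ => c) ∈ PolyFun ι :=
  (PolyFun ι).algebraMap_mem c

theorem mul {f g : (ι → ℂ) → ℂ} (hf : f ∈ PolyFun ι) (hg : g ∈ PolyFun ι) :
    (fun x => f x * g x) ∈ PolyFun ι :=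
  (PolyFun ι).mul_mem hf hg

theorem sum {κ : Type*} {s : Finset κ} {f : κ → (ι → ℂ) → ℂ} (h : ∀ k ∈ s, f k ∈ PolyFun ι) :
    (fun x => ∑ k ∈ s, f k x) ∈ PolyFun ι := by
  convert (PolyFun ι).sum_mem h using 1
  ext x; simp

theorem prod {κ : Type*} {s : Finset κ} {f : κ → (ι → ℂ) → ℂ} (h : ∀ k ∈ s, f k ∈ PolyFun ι) :
    (fun x => ∏ k ∈ s, f k x) ∈ PolyFun ι := by
  convert (PolyFun ι).prod_mem h using 1
  ext x; simp

theorem det {n : Type*} [Fintype n] [DecidableEq n] {A : (ι → ℂ) → Matrix n n ℂ}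
    (h : ∀ i j, (fun x => A x i j) ∈ PolyFun ι) : (fun x => (A x).det) ∈ PolyFun ι := by
  simp only [Matrix.det_apply']
  exact sum fun σ _ => mul (const _) (prod fun i _ => h _ _)

theorem adjugate {n : Type*} [Fintype n] [DecidableEq n] {A : (ι → ℂ) → Matrix n n ℂ}
    (h : ∀ i j, (fun x => A x i j) ∈ PolyFun ι) (i j : n) :
    (fun x => (A x).adjugate i j) ∈ PolyFun ι := by
  simp only [Matrix.adjugate_apply]
  refine det fun a b => ?_
  simp only [Matrix.updateRow_apply]
  split_ifs
  · exact const _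
  · exact h _ _

theorem matMul {l m n : Type*} [Fintype m] {A : (ι → ℂ) → Matrix l m ℂ}
    {B : (ι → ℂ) → Matrix m n ℂ} (hA : ∀ i j, (fun x => A x i j) ∈ PolyFun ι)
    (hB : ∀ i j, (fun x => B x i j) ∈ PolyFun ι) (i : l) (j : n) :
    (fun x => (A x * B x) i j) ∈ PolyFun ι := by
  simp only [Matrix.mul_apply]
  exact sum fun k _ => mul (hA _ _) (hB _ _)

theorem comp {κ : Type*} {f : (κ → ℂ) → ℂ} (hf : f ∈ PolyFun κ) {g : (ι → ℂ) → κ → ℂ}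
    (hg : ∀ k, (fun x => g x k) ∈ PolyFun ι) : (fun x => f (g x)) ∈ PolyFun ι := by
  induction hf using Algebra.adjoin_induction with
  | mem f hf => obtain ⟨k, rfl⟩ := hf; exact hg k
  | algebraMap c => exact const c
  | add f f' _ _ h h' => exact (PolyFun ι).add_mem h h'
  | mul f f' _ _ h h' => exact (PolyFun ι).mul_mem h h'

theorem continuous {f : (ι → ℂ) → ℂ} (hf : f ∈ PolyFun ι) : Continuous f := by
  induction hf using Algebra.adjoin_induction with
  | mem f hf => obtain ⟨k, rfl⟩ := hf; exact continuous_apply k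
  | algebraMap c => exact continuous_const
  | add f f' _ _ h h' => exact h.add h'
  | mul f f' _ _ h h' => exact h.mul h'

theorem exists_polynomial [DecidableEq ι] {f : (ι → ℂ) → ℂ} (hf : f ∈ PolyFun ι) (x : ι → ℂ)
    (i : ι) : ∃ p : Polynomial ℂ, ∀ z, f (Function.update x i z) = p.eval z := by
  induction hf using Algebra.adjoin_induction with
  | mem f hf =>
    obtain ⟨k, rfl⟩ := hf
    by_cases h : k = i
    · subst h; exact ⟨Polynomial.X, fun z => by simp⟩
    · exact ⟨Polynomial.C (x k), fun z => by simp [h]⟩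
  | algebraMap c => exact ⟨Polynomial.C c, fun z => by simp⟩
  | add f f' _ _ h h' =>
    obtain ⟨p, hp⟩ := h
    obtain ⟨p', hp'⟩ := h'
    exact ⟨p + p', fun z => by simp [hp, hp']⟩
  | mul f f' _ _ h h' =>
    obtain ⟨p, hp⟩ := h
    obtain ⟨p', hp'⟩ := h'
    exact ⟨p * p', fun z => by simp [hp, hp']⟩

/-- A polynomial function that is not identically zero vanishes almost nowhere, for every product
of diffuse probability measures. -/
theorem ae_ne_zero [Fintype ι] {f : (ι → ℂ) → ℂ} (hf : f ∈ PolyFun ι) (x₀ : ι → ℂ)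
    (h₀ : f x₀ ≠ 0) (ν : Measure ℂ) [IsProbabilityMeasure ν] [NullSingletonClass ν] :
    ∀ᵐ x ∂(Measure.pi fun _ : ι => ν), f x ≠ 0 := by
  classical
  have hc := continuous hf
  have hpw : ∀ s : Finset ι, Continuous fun x : ι → ℂ => s.piecewise x x₀ := by
    intro s
    refine continuous_pi fun j => ?_
    by_cases hj : j ∈ s <;> simp only [Finset.piecewise, hj, if_true, if_false] <;> fun_prop
  -- The coordinates of `x₀` are replaced by random ones one at a time. Each replacement meets a
  -- nonzero polynomial in one variable, whose finitely many roots are null for a diffuse law.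
  suffices H : ∀ s : Finset ι, ∀ᵐ x ∂(Measure.pi fun _ : ι => ν), f (s.piecewise x x₀) ≠ 0 by
    simpa using H Finset.univ
  intro s
  induction s using Finset.induction_on with
  | empty => simp [h₀]
  | insert i s hi ih =>
    have hnull : Measure.pi (fun _ : ι => ν)
        {x | f (s.piecewise x x₀) ≠ 0 ∧ f ((insert i s).piecewise x x₀) = 0} ≤ 0 := by
      refine pi_measure_le_of_section ν ?_ i fun x => ?_
      · have h1 : Measurable fun x : ι → ℂ => f (s.piecewise x x₀) :=
          (hc.comp (hpw s)).measurable
        have h2 : Measurable fun x : ι → ℂ => f ((insert i s).piecewise x x₀) :=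
          (hc.comp (hpw _)).measurable
        exact ((measurableSet_singleton (0 : ℂ)).compl.preimage h1).inter
          ((measurableSet_singleton (0 : ℂ)).preimage h2)
      · have e1 : ∀ z, s.piecewise (Function.update x i z) x₀ = s.piecewise x x₀ := by
          intro z; ext j
          by_cases hj : j ∈ s
          · have : j ≠ i := fun h => hi (h ▸ hj)
            simp [hj, this]
          · simp [hj]
        have e2 : ∀ z, (insert i s).piecewise (Function.update x i z) x₀ =
            Function.update (s.piecewise x x₀) i z := by
          intro z; rw [Finset.piecewise_insert, e1]; simp
        obtain ⟨p, hp⟩ := exists_polynomial hf (s.piecewise x x₀) i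
        simp only [Set.mem_ofPred_eq, e1, e2, hp]
        by_cases hz : f (s.piecewise x x₀) = 0
        · simp [hz]
        · have hp0 : p ≠ 0 := by
            rintro rfl
            apply hz
            have := hp (s.piecewise x x₀ i)
            simpa using this
          refine (measure_mono (t := (p.roots.toFinset : Set ℂ)) fun z hz => ?_).trans
            (Set.Finite.measure_zero (Finset.finite_toSet _) ν).le
          simpa [hp0] using hz.2
    have hn := nonpos_iff_eq_zero.1 hnull
    rw [measure_eq_zero_iff_ae_notMem] at hn
    filter_upwards [ih, hn] with x hx hx'
    exact fun h => hx' ⟨hx, h⟩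

/-- Finitely many polynomial functions, none of them identically zero, have a common point at which
none of them vanishes. -/
theorem exists_ne_zero [Fintype ι] {κ : Type*} [Finite κ] {f : κ → (ι → ℂ) → ℂ}
    (hf : ∀ k, f k ∈ PolyFun ι) (h : ∀ k, ∃ x, f k x ≠ 0) : ∃ x, ∀ k, f k x ≠ 0 := by
  let ν : Measure ℂ := volume.restrict (Metric.ball 0 1)
  have hfin : IsFiniteMeasure ν := ⟨by simp [ν]⟩
  have hne : ν ≠ 0 := by
    intro h0
    have : ν Set.univ = 0 := by simp [h0]
    simp only [ν, Measure.restrict_apply_univ] at this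
    exact (Metric.measure_ball_pos volume (0 : ℂ) one_pos).ne' this
  have : NeZero ν := ⟨hne⟩
  have : NullSingletonClass ν := by
    refine ⟨fun x => ?_⟩
    exact le_antisymm ((Measure.restrict_apply_le _ _).trans (by simp)) bot_le
  let ν' : Measure ℂ := (ν Set.univ)⁻¹ • ν
  have : IsProbabilityMeasure ν' := isProbabilityMeasureSMul
  have : NullSingletonClass ν' := ⟨fun x => by simp [ν']⟩
  have H : ∀ᵐ x ∂(Measure.pi fun _ : ι => ν'), ∀ k, f k x ≠ 0 := by
    rw [ae_all_iff]
    intro k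
    obtain ⟨x, hx⟩ := h k
    exact ae_ne_zero (hf k) x hx ν'
  exact H.exists

end PolyFun

/-- A polynomial function of the channel coefficients that is not identically zero is nonzero for
almost every channel. -/
theorem forAlmostEveryChannel_ne_zero {M N : ℕ} {f : Channel M N → ℂ}
    (hf : f ∈ PolyFun (Fin 3 × Fin 3 × Fin N × Fin M)) (H₀ : Channel M N) (h₀ : f H₀ ≠ 0) :
    ForAlmostEveryChannel M N fun H => f H ≠ 0 := by
  intro ν _ hac
  have : NullSingletonClass ν := ⟨fun x => hac (by simp)⟩
  exact PolyFun.ae_ne_zero hf H₀ h₀ ν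

theorem ForAlmostEveryChannel.mono {M N : ℕ} {Q Q' : Channel M N → Prop}
    (h : ForAlmostEveryChannel M N Q) (hQ : ∀ H, Q H → Q' H) : ForAlmostEveryChannel M N Q' :=
  fun ν hν hac => (h ν hν hac).mono hQ

theorem ForAlmostEveryChannel.all {M N : ℕ} {κ : Type*} [Countable κ]
    {Q : κ → Channel M N → Prop} (h : ∀ k, ForAlmostEveryChannel M N (Q k)) :
    ForAlmostEveryChannel M N fun H => ∀ k, Q k H :=
  fun ν hν hac => ae_all_iff.2 fun k => h k ν hν hac

theorem ForAlmostEveryChannel.and {M N : ℕ} {Q Q' : Channel M N → Prop}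
    (h : ForAlmostEveryChannel M N Q) (h' : ForAlmostEveryChannel M N Q') :
    ForAlmostEveryChannel M N fun H => Q H ∧ Q' H :=
  fun ν hν hac => (h ν hν hac).and (h' ν hν hac)

/-! ### Alternating transmission with zero-forcing receivers -/

/-- The receive group that excludes receiver `j`. -/
def groupExcluding (j : Fin 3) : RxGroup :=
  ⟨{j}ᶜ, by rw [Finset.card_compl]; simp⟩

theorem groupExcluding_injective : Function.Injective groupExcluding := by
  intro i j h
  have := congrArg Subtype.val h
  simpa [groupExcluding] using this

theorem mem_groupExcluding {i j : Fin 3} : i ∈ (groupExcluding j).1 ↔ i ≠ j := by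
  simp [groupExcluding]

theorem exists_eq_groupExcluding (S : RxGroup) : ∃ j, S = groupExcluding j := by
  have h : (S.1ᶜ).card = 1 := by rw [Finset.card_compl, S.2]; simp
  obtain ⟨j, hj⟩ := Finset.card_eq_one.1 h
  exact ⟨j, Subtype.ext (by simp [groupExcluding, ← hj])⟩

theorem LinearScheme.seen_apply {M N s : ℕ} {τ : Type} [Fintype τ] [DecidableEq τ]
    (L : LinearScheme M N s τ) (H : Channel M N) (j : Fin 3) (S : RxGroup) (p : Fin 3)
    (i : τ × {n // n ∈ L.active j}) (c : Fin s) :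
    L.seen H j S p i c = ∑ m, H (j, p, i.2.1, m) * L.V S p (i.1, m) c := by
  simp [LinearScheme.seen, Matrix.mul_apply, Fintype.sum_prod_type, Matrix.one_apply, link]

/-- The first `K` antennas. -/
def firstAntennas (N K : ℕ) : Finset (Fin N) := Finset.univ.filter fun n => (n : ℕ) < K

/-- The first `K` of `N` antennas are `K` in number. -/
def firstAntennasEquiv {N K : ℕ} (h : K ≤ N) : {n // n ∈ firstAntennas N K} ≃ Fin K where
  toFun n := ⟨n.1, by simpa [firstAntennas] using n.2⟩
  invFun n := ⟨Fin.castLE h n, by simp [firstAntennas]⟩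
  left_inv n := by ext; simp
  right_inv n := by ext; simp

section Alternating

variable {M N K : ℕ}

/-- The antenna that carries the stream `c` when every antenna carries three streams. -/
def streamAntenna (hM : K ≤ 3 * M) (c : Fin K) : Fin M := ⟨c / 3, by omega⟩

/-- In phase `k` transmitter `p` serves the group excluding receiver `k + p`, and sends the stream
`c` uncoded in the slot `c + p` modulo three. -/
def alternatingScheme (N : ℕ) (hM : K ≤ 3 * M) : LinearScheme M N K (Fin 3 × Fin 3) where
  active _ := firstAntennas N K
  V S p := Matrix.of fun i c =>
    if S = groupExcluding (i.1.1 + p) ∧ i.1.2 = Fin.ofNat 3 c + p ∧ i.2 = streamAntenna hM c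
    then 1 else 0

/-- The matrix through which receiver `j` sees the streams sent in the slot `τ` of each phase. -/
def slotMatrix (hM : K ≤ 3 * M) (hN : K ≤ N) (H : Channel M N) (j τ : Fin 3) :
    Matrix (Fin K) (Fin K) ℂ :=
  Matrix.of fun n c => H (j, τ - Fin.ofNat 3 c, Fin.castLE hN n, streamAntenna hM c)

/-- The index `c` is determined by its antenna `c / 3` and its residue modulo three, which fixes the
transmitter that sends it in slot `τ`. The columns therefore involve distinct channel coefficients,
and a zero-one channel turns the matrix into the identity. -/
theorem ae_slotMatrix_det_ne_zero (hM : K ≤ 3 * M) (hN : K ≤ N) (j τ : Fin 3) :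
    ForAlmostEveryChannel M N fun H => (slotMatrix hM hN H j τ).det ≠ 0 := by
  refine forAlmostEveryChannel_ne_zero (PolyFun.det fun n c => PolyFun.coord _)
    (fun i => if (i.2.2.1 : ℕ) / 3 = i.2.2.2 ∧ Fin.ofNat 3 i.2.2.1 + i.2.1 = τ then 1 else 0) ?_
  have : slotMatrix hM hN (fun i => if (i.2.2.1 : ℕ) / 3 = i.2.2.2 ∧
      Fin.ofNat 3 i.2.2.1 + i.2.1 = τ then 1 else 0) j τ = 1 := by
    ext n c
    rw [Matrix.one_apply]
    simp only [slotMatrix, streamAntenna, Matrix.of_apply, Fin.val_castLE]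
    refine if_congr ⟨fun ⟨h1, h2⟩ => ?_, ?_⟩ rfl rfl
    · have h3 : Fin.ofNat 3 (n : ℕ) = Fin.ofNat 3 (c : ℕ) := by
        have h2' := h2
        rw [← add_sub_assoc, sub_eq_iff_eq_add, add_comm τ] at h2'
        exact add_right_cancel h2'
      have h4 := congrArg Fin.val h3
      simp only [Fin.val_ofNat] at h4
      ext; omega
    · rintro rfl
      simp
  rw [this]
  simp

theorem alternatingScheme_alternating (hM : K ≤ 3 * M) :
    (alternatingScheme N hM).Alternating := by
  refine ⟨fun k p => groupExcluding (k + p), fun k p q h => ?_, fun p k l h => ?_, ?_⟩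
  · exact add_left_cancel (groupExcluding_injective h)
  · exact add_right_cancel (groupExcluding_injective h)
  · intro k i p S hS m c
    simp [alternatingScheme, hS]

/-- In each slot every index `c` is sent by exactly one transmitter, so `K` antennas face `K`
unknown streams, and inverting `slotMatrix` separates all of them, undesired ones included. The same
matrix serves all phases because the channel is constant. -/
theorem alternatingScheme_decodable (hM : K ≤ 3 * M) (hN : K ≤ N) {H : Channel M N}
    (hH : ∀ j τ, (slotMatrix hM hN H j τ).det ≠ 0) : (alternatingScheme N hM).Decodable H := by
  classical
  intro j S _ p
  obtain ⟨g, rfl⟩ := exists_eq_groupExcluding S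
  let Ψ := fun τ => (slotMatrix hM hN H j τ)⁻¹
  have hΨ : ∀ τ, Ψ τ * slotMatrix hM hN H j τ = 1 := fun τ =>
    Matrix.nonsing_inv_mul _ (isUnit_iff_ne_zero.2 (hH j τ))
  let e : {n // n ∈ (alternatingScheme N hM).active j} ≃ Fin K := firstAntennasEquiv hN
  -- Transmitter `p` serves the group excluding `g` in phase `g - p` only, and its stream `c` uses
  -- slot `c + p`; the combiner reads that single channel use.
  let U : Matrix (Fin K) ((Fin 3 × Fin 3) × {n // n ∈ (alternatingScheme N hM).active j}) ℂ :=
    Matrix.of fun c i => if i.1 = (g - p, Fin.ofNat 3 c + p) then Ψ i.1.2 c (e i.2) else 0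
  have hseen : ∀ (S' : RxGroup) (p' : Fin 3)
      (i : (Fin 3 × Fin 3) × {n // n ∈ (alternatingScheme N hM).active j}) (c : Fin K), (alternatingScheme N hM).seen H j S' p' i c =
      if S' = groupExcluding (i.1.1 + p') ∧ i.1.2 = Fin.ofNat 3 c + p' then
        H (j, p', i.2.1, streamAntenna hM c) else 0 := by
    intro S' p' i c
    rw [LinearScheme.seen_apply]
    simp only [alternatingScheme, Matrix.of_apply, mul_ite, mul_one, mul_zero, ← and_assoc]
    split_ifs with h
    · simp [h]
    · simp only [h, false_and, if_false, Finset.sum_const_zero]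
  have key : ∀ (S' : RxGroup) (p' : Fin 3) (c c' : Fin K),
      (U * (alternatingScheme N hM).seen H j S' p') c c' =
      if S' = groupExcluding (g - p + p') ∧ Fin.ofNat 3 c + p = Fin.ofNat 3 c' + p' ∧ c = c' then 1
      else 0 := by
    intro S' p' c c'
    rw [Matrix.mul_apply, Fintype.sum_prod_type, Finset.sum_eq_single (g - p, Fin.ofNat 3 c + p)]
    · simp only [hseen, U, Matrix.of_apply, if_true]
      by_cases h1 : S' = groupExcluding (g - p + p') ∧ Fin.ofNat 3 c + p = Fin.ofNat 3 c' + p'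
      · have h3 := congrFun (congrFun (hΨ (Fin.ofNat 3 c + p)) c) c'
        rw [Matrix.mul_apply, Matrix.one_apply] at h3
        simp only [h1, true_and, and_true, if_true]
        rw [← h1.2, ← h3]
        refine Fintype.sum_equiv e _ _ fun n => ?_
        have h4 : Fin.ofNat 3 (c : ℕ) + p - Fin.ofNat 3 (c' : ℕ) = p' := by rw [h1.2]; simp
        simp only [slotMatrix, Matrix.of_apply, h4]
        rfl
      · rw [if_neg fun h => h1 ⟨h.1, h.2.1⟩]
        simp only [h1, if_false, mul_zero, Finset.sum_const_zero]
    · intro b _ hb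
      refine Finset.sum_eq_zero fun n _ => ?_
      simp only [U, Matrix.of_apply, hb, if_false, zero_mul]
    · simp
  refine ⟨U, ?_, fun S' p' hne => ?_⟩
  · ext c c'
    rw [key, Matrix.one_apply]
    refine if_congr ⟨fun h => h.2.2, ?_⟩ rfl rfl
    rintro rfl
    simp
  · ext c c'
    rw [key, Matrix.zero_apply, if_neg]
    rintro ⟨h1, h2, rfl⟩
    apply hne
    have : p = p' := add_left_cancel h2
    subst this
    rw [h1]; simp

/-- Alternating transmission attains `2 * K / 3` degrees of freedom per user if `K` does not
exceed the number of receive antennas nor the total number of transmit antennas. -/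
theorem exists_alternating_scheme (hM : K ≤ 3 * M) (hN : K ≤ N) :
    ForAlmostEveryChannel M N fun H => ∃ L : LinearScheme M N K (Fin 3 × Fin 3),
      L.Decodable H ∧ L.Alternating ∧ L.dof = 2 * K / 3 := by
  refine (ForAlmostEveryChannel.all fun j => ForAlmostEveryChannel.all fun τ =>
    ae_slotMatrix_det_ne_zero hM hN j τ).mono fun H hH => ⟨alternatingScheme N hM,
      alternatingScheme_decodable hM hN hH, alternatingScheme_alternating hM, ?_⟩
  simp only [LinearScheme.dof, Fintype.card_prod, Fintype.card_fin]
  push_cast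
  ring

end Alternating

/-! ### Interference alignment -/

/-- The receiver that is not contained in a receive group. -/
def excluded (S : RxGroup) : Fin 3 := (exists_eq_groupExcluding S).choose

@[simp] theorem excluded_groupExcluding (j : Fin 3) : excluded (groupExcluding j) = j :=
  groupExcluding_injective (exists_eq_groupExcluding (groupExcluding j)).choose_spec.symm

/-- The dimensions of the signal space of a receiver: six for the desired messages, and `none` for
the aligned interference. -/
abbrev SignalDim : Type := Option (Fin 2 × Fin 3)

/-- The seven channel uses, labelled by the seven dimensions of the signal space. -/
def timeEquiv : Fin 7 ≃ SignalDim := Fintype.equivOfCardEq (by simp)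

/-- The message seen by receiver `j` in a given dimension of its signal space. -/
def dimMessage (j : Fin 3) : SignalDim → RxGroup × Fin 3
  | none => (groupExcluding j, 0)
  | some (b, p) => (groupExcluding (j + 1 + b.castSucc), p)

theorem exists_dim_of_ne {j g : Fin 3} (h : j ≠ g) : ∃ b : Fin 2, g = j + 1 + b.castSucc := by
  revert j g; decide

theorem dim_ne (j : Fin 3) (b : Fin 2) : j + 1 + b.castSucc ≠ j := by
  revert j b; decide

/-! ### Zero forcing in the presence of aligned interference. -/

section Decoding

variable {M N K : ℕ} (L : LinearScheme M N K (Fin 7)) (H : Channel M N) (j : Fin 3)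
  (e : {n // n ∈ L.active j} ≃ Fin K)

/-- The square matrix through which receiver `j` sees its desired streams and the interference. -/
def receiverMatrix : Matrix (SignalDim × Fin K) (SignalDim × Fin K) ℂ :=
  Matrix.of fun a b => L.seen H j (dimMessage j b.1).1 (dimMessage j b.1).2
    (timeEquiv.symm a.1, e.symm a.2) b.2

variable {L H j}

/-- The square matrix has six blocks of desired columns and one block for the interference of
transmitter 0. Rows of its inverse extract a desired block and null that representative, hence by
alignment all three undesired signals. -/
theorem exists_combining_of_det_ne_zero
    (hal : ∀ S : RxGroup, j ∉ S.1 → ∀ p p' : Fin 3, L.seen H j S p = L.seen H j S p')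
    (hdet : (receiverMatrix L H j e).det ≠ 0) {S : RxGroup} (hS : j ∈ S.1) (p : Fin 3) :
    ∃ U : Matrix (Fin K) (Fin 7 × {n // n ∈ L.active j}) ℂ, U * L.seen H j S p = 1 ∧
      ∀ (S' : RxGroup) (p' : Fin 3), (S', p') ≠ (S, p) → U * L.seen H j S' p' = 0 := by
  obtain ⟨g, rfl⟩ := exists_eq_groupExcluding S
  obtain ⟨b, rfl⟩ := exists_dim_of_ne (mem_groupExcluding.1 hS)
  let Ψ := (receiverMatrix L H j e)⁻¹
  have hΨ : Ψ * receiverMatrix L H j e = 1 :=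
    Matrix.nonsing_inv_mul _ (isUnit_iff_ne_zero.2 hdet)
  let U : Matrix (Fin K) (Fin 7 × {n // n ∈ L.active j}) ℂ :=
    Matrix.of fun c i => Ψ (some (b, p), c) (timeEquiv i.1, e i.2)
  have key : ∀ (o : SignalDim) (c c' : Fin K),
      (U * L.seen H j (dimMessage j o).1 (dimMessage j o).2) c c' =
        if (some (b, p), c) = (o, c') then 1 else 0 := by
    intro o c c'
    have h := congrFun (congrFun hΨ (some (b, p), c)) (o, c')
    rw [Matrix.one_apply] at h
    rw [← h, Matrix.mul_apply, Matrix.mul_apply]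
    refine Fintype.sum_equiv (timeEquiv.prodCongr e) _ _ fun i => ?_
    simp [U, receiverMatrix, Prod.map]
  have key' : ∀ (S' : RxGroup) (p' : Fin 3), ∃ o : SignalDim,
      L.seen H j S' p' = L.seen H j (dimMessage j o).1 (dimMessage j o).2 ∧
      (o = some (b, p) → (S', p') = (groupExcluding (j + 1 + b.castSucc), p)) := by
    intro S' p'
    obtain ⟨g', rfl⟩ := exists_eq_groupExcluding S'
    by_cases hg : j = g'
    · subst hg
      exact ⟨none, hal _ (by simp [mem_groupExcluding]) _ _, by simp⟩
    · obtain ⟨b', rfl⟩ := exists_dim_of_ne hg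
      refine ⟨some (b', p'), rfl, fun h => ?_⟩
      simp only [Option.some.injEq, Prod.mk.injEq] at h
      rw [h.1, h.2]
  refine ⟨U, ?_, fun S' p' hne => ?_⟩
  · ext c c'
    have := key (some (b, p)) c c'
    simp only [dimMessage] at this
    rw [this, Matrix.one_apply]
    simp
  · obtain ⟨o, ho, ho'⟩ := key' S' p'
    rw [ho]
    ext c c'
    rw [key, Matrix.zero_apply, if_neg]
    rintro h
    exact hne (ho' (Prod.mk.inj h).1.symm)

end Decoding

/-! ### Alignment by channel inversion, reduced to one good point per receiver. -/

section Alignment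

variable {M N K : ℕ}

/-- The channel matrix between the first `K` antennas of transmitter `p` and receiver `j`. -/
def squareLink (hM : K ≤ M) (hN : K ≤ N) (H : Channel M N) (j p : Fin 3) :
    Matrix (Fin K) (Fin K) ℂ :=
  Matrix.of fun n m => H (j, p, Fin.castLE hN n, Fin.castLE hM m)

/-- The common matrix through which the interference is to be received, for each receiver. -/
abbrev AlignedParam (K : ℕ) : Type := Fin 3 × SignalDim × Fin K × Fin K

/-- The streams sent on beams that are invisible to the unintended receiver. -/
abbrev NulledParam (K : ℕ) : Type := Fin 3 × Fin 3 × SignalDim × Fin K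

/-- The cofactor which makes the interference of transmitter `p` at receiver `j` independent
of `p`. -/
def cofactor (hM : K ≤ M) (hN : K ≤ N) (H : Channel M N) (j p : Fin 3) : ℂ :=
  ∏ q ∈ Finset.univ.erase p, (squareLink hM hN H j q).det

/-- The block of `W` for receiver `j` and the channel use `o`. -/
def alignedBlock (W : AlignedParam K → ℂ) (j : Fin 3) (o : SignalDim) :
    Matrix (Fin K) (Fin K) ℂ :=
  Matrix.of fun n c => W (j, o, n, c)

/-- A scheme that inverts the channel to the unintended receiver, so that the interference is
received through the matrix `W`, and adds signals on beams `β` that this receiver does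
not see. -/
def alignedScheme (hM : K ≤ M) (hN : K ≤ N) (β : Channel M N → Fin 3 → Fin 3 → Fin M → ℂ)
    (W : AlignedParam K → ℂ) (Z : NulledParam K → ℂ) (H : Channel M N) :
    LinearScheme M N K (Fin 7) where
  active _ := firstAntennas N K
  V S p := Matrix.of fun i c =>
    (∑ m : Fin K, if Fin.castLE hM m = i.2 then cofactor hM hN H (excluded S) p *
      ((squareLink hM hN H (excluded S) p).adjugate *
        alignedBlock W (excluded S) (timeEquiv i.1)) m c else 0) +
    β H (excluded S) p i.2 * Z (excluded S, p, timeEquiv i.1, c)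

variable (hM : K ≤ M) (hN : K ≤ N) (β : Channel M N → Fin 3 → Fin 3 → Fin M → ℂ)
    (W : AlignedParam K → ℂ) (Z : NulledParam K → ℂ) (H : Channel M N)

/-- The signal of transmitter `p` for the group excluding `j` as seen by receiver `k`. -/
def alignedSeen (k j p : Fin 3) (o : SignalDim) (n c : Fin K) : ℂ :=
  cofactor hM hN H j p * (squareLink hM hN H k p * ((squareLink hM hN H j p).adjugate *
    alignedBlock W j o)) n c +
  (∑ m, H (k, p, Fin.castLE hN n, m) * β H j p m) * Z (j, p, o, c)

theorem alignedScheme_seen (k j p : Fin 3)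
    (i : Fin 7 × {n // n ∈ (alignedScheme hM hN β W Z H).active k}) (c : Fin K) :
    (alignedScheme hM hN β W Z H).seen H k (groupExcluding j) p i c =
      alignedSeen hM hN β W Z H k j p (timeEquiv i.1) (firstAntennasEquiv hN i.2) c := by
  rw [LinearScheme.seen_apply]
  simp only [alignedScheme, Matrix.of_apply, excluded_groupExcluding, mul_add,
    Finset.sum_add_distrib, alignedSeen]
  congr 1
  · simp only [Finset.mul_sum]
    rw [Finset.sum_comm, Matrix.mul_apply, Finset.mul_sum]
    refine Finset.sum_congr rfl fun m _ => ?_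
    simp only [mul_ite, mul_zero, Finset.sum_ite_eq, Finset.mem_univ, if_true, squareLink,
      Matrix.of_apply]
    rw [mul_left_comm]
    rfl
  · rw [Finset.sum_mul]
    exact Finset.sum_congr rfl fun m _ => (mul_assoc _ _ _).symm

/-- A matrix times its adjugate is its determinant, which completes the cofactor to the product over
all transmitters; the result no longer depends on `p`. -/
theorem alignedSeen_self
    (hβ : ∀ H j p n, ∑ m, H (j, p, Fin.castLE hN n, m) * β H j p m = 0) (j p : Fin 3)
    (o : SignalDim) (n c : Fin K) : alignedSeen hM hN β W Z H j j p o n c =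
      (∏ q, (squareLink hM hN H j q).det) * W (j, o, n, c) := by
  rw [alignedSeen, hβ, zero_mul, add_zero, ← Matrix.mul_assoc, Matrix.mul_adjugate,
    Matrix.smul_mul, Matrix.one_mul, Matrix.smul_apply, smul_eq_mul, ← mul_assoc, cofactor,
    Finset.prod_erase_mul _ _ (Finset.mem_univ p)]
  rfl

theorem alignedScheme_aligned
    (hβ : ∀ H j p n, ∑ m, H (j, p, Fin.castLE hN n, m) * β H j p m = 0) :
    (alignedScheme hM hN β W Z H).Aligned H := by
  intro j S hS p p'
  obtain ⟨g, rfl⟩ := exists_eq_groupExcluding S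
  have hg : j = g := not_not.1 fun h => hS (mem_groupExcluding.2 h)
  subst hg
  ext i c
  rw [alignedScheme_seen, alignedScheme_seen, alignedSeen_self _ _ _ _ _ _ hβ,
    alignedSeen_self _ _ _ _ _ _ hβ]

/-- The square matrix through which receiver `k` sees its desired streams and the interference,
in the coordinates of `SignalDim`. -/
def alignedMatrix (k : Fin 3) : Matrix (SignalDim × Fin K) (SignalDim × Fin K) ℂ :=
  Matrix.of fun a b => alignedSeen hM hN β W Z H k (excluded (dimMessage k b.1).1)
    (dimMessage k b.1).2 a.1 a.2 b.2

theorem receiverMatrix_alignedScheme (k : Fin 3) :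
    receiverMatrix (alignedScheme hM hN β W Z H) H k (firstAntennasEquiv hN) =
      alignedMatrix hM hN β W Z H k := by
  ext a b
  obtain ⟨g, hg⟩ := exists_eq_groupExcluding (dimMessage k b.1).1
  simp only [receiverMatrix, alignedMatrix, Matrix.of_apply]
  rw [hg, alignedScheme_seen, excluded_groupExcluding, Equiv.apply_symm_apply]
  exact congrArg (fun n => alignedSeen hM hN β W Z H k g (dimMessage k b.1).2 a.1 n b.2)
    (Equiv.apply_symm_apply _ a.2)

theorem alignedScheme_decodable
    (hβ : ∀ H j p n, ∑ m, H (j, p, Fin.castLE hN n, m) * β H j p m = 0)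
    (hdet : ∀ k, (alignedMatrix hM hN β W Z H k).det ≠ 0) :
    (alignedScheme hM hN β W Z H).Decodable H := by
  intro j S hS p
  refine exists_combining_of_det_ne_zero (firstAntennasEquiv hN)
    (alignedScheme_aligned hM hN β W Z H hβ j) ?_ hS p
  rw [receiverMatrix_alignedScheme]
  exact hdet j

/-- The indices of the coefficients of the channel, of `W` and of `Z`. -/
abbrev JointParam (M N K : ℕ) : Type :=
  (Fin 3 × Fin 3 × Fin N × Fin M) ⊕ (AlignedParam K ⊕ NulledParam K)

/-- Adjugates and cofactors in place of inverses are what make the determinant a polynomial. Its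
coordinates are left abstract so that it can be used both jointly in channel and parameters, and in
the channel alone. -/
theorem alignedMatrix_polyFun {ι : Type*} {H : (ι → ℂ) → Channel M N}
    {W : (ι → ℂ) → AlignedParam K → ℂ} {Z : (ι → ℂ) → NulledParam K → ℂ}
    (hH : ∀ i, (fun x => H x i) ∈ PolyFun ι) (hW : ∀ i, (fun x => W x i) ∈ PolyFun ι)
    (hZ : ∀ i, (fun x => Z x i) ∈ PolyFun ι)
    (hβ : ∀ j p m, (fun H => β H j p m) ∈ PolyFun (Fin 3 × Fin 3 × Fin N × Fin M))
    (k : Fin 3) :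
    (fun x => (alignedMatrix hM hN β (W x) (Z x) (H x) k).det) ∈ PolyFun ι := by
  have hsq : ∀ j p n m, (fun x => squareLink hM hN (H x) j p n m) ∈ PolyFun ι :=
    fun j p n m => hH _
  refine PolyFun.det fun a b => ?_
  simp only [alignedMatrix, Matrix.of_apply, alignedSeen, cofactor]
  refine (PolyFun ι).add_mem (PolyFun.mul (PolyFun.prod fun q _ => PolyFun.det fun i j => ?_)
    (PolyFun.matMul (fun i j => ?_) (PolyFun.matMul (PolyFun.adjugate fun i j => ?_)
      fun i j => hW _) _ _))
    (PolyFun.mul (PolyFun.sum fun m _ => PolyFun.mul (hH _) ?_) (hZ _))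
  · exact hsq _ _ _ _
  · exact hsq _ _ _ _
  · exact hsq _ _ _ _
  · exact PolyFun.comp (hβ _ _ _) hH

/-- If every receiver can decode for some choice of the channel and of the parameters of the
aligned scheme, then all receivers can decode for almost every channel. -/
theorem exists_aligned_scheme_of_points
    (hβ : ∀ H j p n, ∑ m, H (j, p, Fin.castLE hN n, m) * β H j p m = 0)
    (hβ' : ∀ j p m, (fun H => β H j p m) ∈ PolyFun (Fin 3 × Fin 3 × Fin N × Fin M))
    (h : ∀ k, ∃ (H : Channel M N) (W : AlignedParam K → ℂ) (Z : NulledParam K → ℂ),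
      (alignedMatrix hM hN β W Z H k).det ≠ 0) :
    ForAlmostEveryChannel M N fun H => ∃ L : LinearScheme M N K (Fin 7),
      L.Decodable H ∧ L.Aligned H ∧ L.dof = 6 * K / 7 := by
  have hjoint : ∀ k, (fun x : JointParam M N K → ℂ => (alignedMatrix hM hN β
      (fun i => x (.inr (.inl i))) (fun i => x (.inr (.inr i))) (fun i => x (.inl i)) k).det) ∈
      PolyFun (JointParam M N K) := fun k =>
    alignedMatrix_polyFun hM hN β (fun i => PolyFun.coord _) (fun i => PolyFun.coord _)
      (fun i => PolyFun.coord _) hβ' k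
  have hpoint : ∀ k, ∃ x : JointParam M N K → ℂ, (alignedMatrix hM hN β
      (fun i => x (.inr (.inl i))) (fun i => x (.inr (.inr i))) (fun i => x (.inl i)) k).det ≠ 0 :=
    fun k => by
      obtain ⟨H, W, Z, hk⟩ := h k
      refine ⟨Sum.elim H (Sum.elim W Z), ?_⟩
      simpa only [Sum.elim_inl, Sum.elim_inr] using hk
  -- The good points of the three receivers need not agree. A common one supplies parameters `W` and
  -- `Z` that can be frozen before the channel is drawn.
  obtain ⟨x, hx⟩ := PolyFun.exists_ne_zero hjoint hpoint
  have hpoly : ∀ k, (fun H => (alignedMatrix hM hN β (fun i => x (.inr (.inl i)))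
      (fun i => x (.inr (.inr i))) H k).det) ∈ PolyFun (Fin 3 × Fin 3 × Fin N × Fin M) := fun k =>
    alignedMatrix_polyFun hM hN β (H := fun H => H) (W := fun _ i => x (.inr (.inl i)))
      (Z := fun _ i => x (.inr (.inr i))) (fun i => PolyFun.coord i)
      (fun i => PolyFun.const (x (.inr (.inl i)))) (fun i => PolyFun.const (x (.inr (.inr i))))
      hβ' k
  have hae := ForAlmostEveryChannel.all fun k =>
    forAlmostEveryChannel_ne_zero (hpoly k) (fun i => x (.inl i)) (hx k)
  refine hae.mono fun H hH => ⟨_, alignedScheme_decodable hM hN β _ _ H hβ hH,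
    alignedScheme_aligned hM hN β _ _ H hβ, ?_⟩
  simp [LinearScheme.dof]

end Alignment

/-! ### At least two antennas at each node: noncommuting link matrices. -/

section SquarePoint

variable {K : ℕ}

/-- The identity, a diagonal matrix with different entries and a cyclic shift. -/
def pointMatrix (K : ℕ) : Fin 3 → Matrix (Fin K) (Fin K) ℂ :=
  ![1, Matrix.diagonal fun n => (n : ℂ) + 1, (finRotate K).permMatrix ℂ]

theorem pointMatrix_det_ne_zero (p : Fin 3) : (pointMatrix K p).det ≠ 0 := by
  fin_cases p
  · simp [pointMatrix]
  · simp only [pointMatrix, Fin.mk_one, Matrix.cons_val_one, Matrix.cons_val_zero,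
      Matrix.det_diagonal]
    exact Finset.prod_ne_zero_iff.2 fun n _ => Nat.cast_add_one_ne_zero _
  · simp only [pointMatrix, Fin.reduceFinMk, Matrix.cons_val, Matrix.det_permutation]
    rcases Int.units_eq_one_or (Equiv.Perm.sign (finRotate K)) with h | h <;> simp [h]

theorem finRotate_ne (hK : 2 ≤ K) (n : Fin K) : finRotate K n ≠ n := by
  obtain ⟨k, rfl⟩ := Nat.exists_eq_add_of_le' hK
  rw [finRotate_apply]
  intro h
  simp at h

/-- Row `n` of the commutator multiplies `v (finRotate K n)` by the difference of two diagonal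
entries, which is nonzero because a rotation of at least two points fixes none. -/
theorem commutator_pointMatrix_injective (hK : 2 ≤ K) {v : Fin K → ℂ}
    (h : (pointMatrix K 1).mulVec ((pointMatrix K 2).mulVec v) =
      (pointMatrix K 2).mulVec ((pointMatrix K 1).mulVec v)) : v = 0 := by
  have key : ∀ n, v (finRotate K n) = 0 := by
    intro n
    have hn := congrFun h n
    simp only [pointMatrix, Matrix.cons_val, Matrix.cons_val_one, Matrix.cons_val_zero,
      Matrix.mulVec_diagonal, Matrix.permMatrix_mulVec, Function.comp_apply] at hn
    have hne : (((finRotate K n : Fin K) : ℕ) : ℂ) ≠ ((n : ℕ) : ℂ) := by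
      exact_mod_cast fun h => finRotate_ne hK n (Fin.ext h)
    have : ((((finRotate K n : Fin K) : ℕ) : ℂ) - n) * v (finRotate K n) = 0 := by
      linear_combination -hn
    exact (mul_eq_zero.1 this).resolve_left (sub_ne_zero.2 hne)
  ext n
  obtain ⟨m, rfl⟩ := (finRotate K).surjective n
  exact key m

/-- Write `1, X, Y` for the three matrices. Subtracting equation `q = 1` from `X` times equation `q
= 0` leaves the commutator of `X` and `Y` applied to `u 2`; then `Y` and equation `q = 2` do the
same for `u 1`. -/
theorem pointMatrix_mul_injective (hK : 2 ≤ K) {u : Fin 3 → Fin K → ℂ}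
    (h : ∀ q, ∑ p, (pointMatrix K p * pointMatrix K q).mulVec (u p) = 0) : u = 0 := by
  have h0 := h 0
  have h1 := h 1
  have h2 := h 2
  have hA0 : pointMatrix K 0 = 1 := rfl
  simp only [Fin.sum_univ_three, hA0, mul_one, one_mul, Matrix.one_mulVec] at h0 h1 h2
  set X := pointMatrix K 1 with hX
  set Y := pointMatrix K 2 with hY
  have e1 := congrArg X.mulVec h0
  have e2 := congrArg Y.mulVec h0
  simp only [Matrix.mulVec_add, Matrix.mulVec_mulVec, Matrix.mulVec_zero] at e1 e2
  have hu2 : u 2 = 0 := by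
    refine commutator_pointMatrix_injective hK ?_
    rw [← hX, ← hY, Matrix.mulVec_mulVec, Matrix.mulVec_mulVec]
    exact add_left_cancel (e1.trans h1.symm)
  have hu1 : u 1 = 0 := by
    refine commutator_pointMatrix_injective hK ?_
    rw [← hX, ← hY, Matrix.mulVec_mulVec, Matrix.mulVec_mulVec]
    have := h2.trans e2.symm
    simpa [hu2] using this
  have hu0 : u 0 = 0 := by simpa [hu1, hu2] using h0
  ext p n
  fin_cases p <;> simp [hu0, hu1, hu2]

/-- The matrices `pointMatrix K q` on the channel uses labelled by `(b, q)`. -/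
def pointBlock (K : ℕ) (b : Fin 2) : SignalDim → Matrix (Fin K) (Fin K) ℂ
  | none => 0
  | some (b', q) => if b = b' then pointMatrix K q else 0

variable {M N : ℕ} (hM : K ≤ M) (hN : K ≤ N)

/-- Receiver `k` gets the links `pointMatrix`, the others identity links. The matrix `W` of receiver
`k` lives in the channel use `none`; that of receiver `k + 1 + b` is `pointMatrix K q` in the
channel use `(b, q)`. The system then splits into a multiple of the identity and, for each `b`, the
system of `pointMatrix_mul_injective`. -/
theorem exists_square_point (hK : 2 ≤ K) (k : Fin 3) :
    ∃ (H : Channel M N) (W : AlignedParam K → ℂ) (Z : NulledParam K → ℂ),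
      (alignedMatrix hM hN (fun _ _ _ _ => 0) W Z H k).det ≠ 0 := by
  classical
  let H : Channel M N := fun i =>
    if h : (i.2.2.1 : ℕ) < K ∧ (i.2.2.2 : ℕ) < K then
      (if i.1 = k then pointMatrix K i.2.1 else 1) ⟨i.2.2.1, h.1⟩ ⟨i.2.2.2, h.2⟩ else 0
  let W : AlignedParam K → ℂ := fun i => (match i.2.1 with
    | none => if i.1 = k then (1 : Matrix (Fin K) (Fin K) ℂ) else 0
    | some (b, q) => if i.1 = k + 1 + b.castSucc then pointMatrix K q else 0) i.2.2.1 i.2.2.2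
  have hH : ∀ j p, squareLink hM hN H j p = if j = k then pointMatrix K p else 1 := by
    intro j p
    ext n m
    simp [squareLink, H]
  refine ⟨H, W, 0, fun hdet => ?_⟩
  obtain ⟨v, hv0, hv⟩ := Matrix.exists_mulVec_eq_zero_iff.2 hdet
  apply hv0
  let D : ℂ := ∏ q, (squareLink hM hN H k q).det
  have hD : D ≠ 0 := Finset.prod_ne_zero_iff.2 fun q _ => by
    rw [hH]; simpa using pointMatrix_det_ne_zero q
  have hWk : ∀ o n c, W (k, o, n, c) = if o = none ∧ n = c then 1 else 0 := by
    intro o n c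
    rcases o with _ | ⟨b, q⟩
    · simp [W, Matrix.one_apply]
    · simp [W, (dim_ne k b).symm]
  have hWb : ∀ b o, alignedBlock W (k + 1 + b.castSucc) o = pointBlock K b o := by
    intro b o
    ext n c
    rcases o with _ | ⟨b', q⟩
    · simp [alignedBlock, W, dim_ne k b, pointBlock]
    · simp [alignedBlock, W, pointBlock]
  have hnone : ∀ o n c, alignedMatrix hM hN (fun _ _ _ _ => 0) W 0 H k (o, n) (none, c) =
      D * if o = none ∧ n = c then 1 else 0 := by
    intro o n c
    simp only [alignedMatrix, Matrix.of_apply, dimMessage, excluded_groupExcluding]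
    rw [alignedSeen_self _ _ _ _ _ _ (by simp), hWk]
  have hsome : ∀ o n b p c, alignedMatrix hM hN (fun _ _ _ _ => 0) W 0 H k (o, n)
      (some (b, p), c) = (pointMatrix K p * pointBlock K b o) n c := by
    intro o n b p c
    simp only [alignedMatrix, Matrix.of_apply, dimMessage, excluded_groupExcluding, alignedSeen,
      cofactor, hH, dim_ne, if_true, if_false, Matrix.adjugate_one, hWb, Matrix.one_mul]
    simp
  have hrow : ∀ o n, (∑ c, D * (if o = none ∧ n = c then 1 else 0) * v (none, c)) +
      ∑ b, ∑ p, ∑ c, (pointMatrix K p * pointBlock K b o) n c * v (some (b, p), c) = 0 := by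
    intro o n
    have := congrFun hv (o, n)
    rw [Matrix.mulVec, dotProduct, Fintype.sum_prod_type, Fintype.sum_option,
      Fintype.sum_prod_type] at this
    simpa only [hnone, hsome, Pi.zero_apply] using this
  ext ⟨o, c⟩
  rcases o with _ | ⟨b, p⟩
  · have := hrow none c
    simpa [hD, pointBlock] using this
  · have hu : (fun p c => v (some (b, p), c)) = 0 := by
      refine pointMatrix_mul_injective hK fun q => ?_
      ext n
      have := hrow (some (b, q)) n
      simp only [reduceCtorEq, false_and, if_false, mul_zero, zero_mul, Finset.sum_const_zero,
        zero_add] at this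
      rw [Finset.sum_eq_single b (fun b' _ hb' => by simp [pointBlock, hb']) (by simp)] at this
      simpa [pointBlock, Matrix.mulVec, dotProduct, Finset.sum_apply] using this
    exact congrFun (congrFun hu p) c

/-- Interference alignment attains `6 * K / 7` degrees of freedom per user if every node has at
least `K` antennas, where `2 ≤ K`. -/
theorem exists_aligned_scheme (hK : 2 ≤ K) (hM : K ≤ M) (hN : K ≤ N) :
    ForAlmostEveryChannel M N fun H => ∃ L : LinearScheme M N K (Fin 7),
      L.Decodable H ∧ L.Aligned H ∧ L.dof = 6 * K / 7 :=
  exists_aligned_scheme_of_points hM hN (fun _ _ _ _ => 0) (by simp)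
    (fun _ _ _ => PolyFun.const 0) fun k => exists_square_point hM hN hK k

end SquarePoint

/-! ### One receive antenna and at least two transmit antennas: invisible beams. -/

section SingleReceiveAntenna

variable {M : ℕ}

/-- A beam of the first two transmit antennas that is orthogonal to the channel to a single
receive antenna. -/
def nullBeam (H : Channel (M + 2) 1) (j p : Fin 3) (m : Fin (M + 2)) : ℂ :=
  (if m = 0 then H (j, p, 0, 1) else 0) - if m = 1 then H (j, p, 0, 0) else 0

/-- This is a two-by-two minor of the channels to receivers `k` and `j`: it vanishes for `k = j` and
gives the beam a free coefficient at the other receivers. -/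
theorem sum_mul_nullBeam (H : Channel (M + 2) 1) (k j p : Fin 3) :
    ∑ m, H (k, p, 0, m) * nullBeam H j p m =
      H (k, p, 0, 0) * H (j, p, 0, 1) - H (k, p, 0, 1) * H (j, p, 0, 0) := by
  simp [nullBeam, mul_sub, Finset.sum_sub_distrib]

/-- The second transmit antenna reaches every receiver but `k`. The beams aimed away from the other
receivers then arrive at `k` with gain one, so `Z` sets the desired columns freely, while `W`
supplies the interference column in the channel use `none`. -/
theorem exists_single_receive_antenna_point (k : Fin 3) :
    ∃ (H : Channel (M + 2) 1) (W : AlignedParam 1 → ℂ) (Z : NulledParam 1 → ℂ),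
      (alignedMatrix (Nat.le_add_left 1 (M + 1)) le_rfl nullBeam W Z H k).det ≠ 0 := by
  classical
  let H : Channel (M + 2) 1 := fun i =>
    if i.2.2.2 = 0 then 1 else if i.2.2.2 = 1 ∧ i.1 ≠ k then 1 else 0
  let W : AlignedParam 1 → ℂ := fun i => if i.1 = k ∧ i.2.1 = none then 1 else 0
  let Z : NulledParam 1 → ℂ := fun i =>
    if ∃ b : Fin 2, i.1 = k + 1 + b.castSucc ∧ i.2.2.1 = some (b, i.2.1) then 1 else 0
  refine ⟨H, W, Z, ?_⟩
  have hsq : ∀ j p, squareLink (Nat.le_add_left 1 (M + 1)) le_rfl H j p = 1 := by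
    intro j p
    ext n m
    rw [Subsingleton.elim n 0, Subsingleton.elim m 0]
    simp [squareLink, H]
  suffices h : alignedMatrix (Nat.le_add_left 1 (M + 1)) le_rfl nullBeam W Z H k = 1 by
    rw [h]; simp
  ext ⟨o, n⟩ ⟨o', c⟩
  have hn : n = 0 := Subsingleton.elim _ _
  have hc : c = 0 := Subsingleton.elim _ _
  subst hn hc
  have hcast : Fin.castLE (le_refl 1) 0 = 0 := rfl
  simp only [alignedMatrix, Matrix.of_apply, alignedSeen, cofactor, hsq, Matrix.adjugate_one,
    Matrix.det_one, Finset.prod_const_one, one_mul, hcast, sum_mul_nullBeam, alignedBlock]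
  rw [Matrix.one_apply]
  rcases o' with _ | ⟨b, p⟩
  · simp [dimMessage, W, H]
  · have h1 : k + 1 + 1 ≠ k := dim_ne k 1
    fin_cases b <;> simp [dimMessage, W, Z, H, h1, Prod.ext_iff]

/-- Interference alignment attains `6 / 7` degrees of freedom per user with a single receive antenna
and at least two transmit antennas. -/
theorem exists_aligned_scheme_single_receive_antenna :
    ForAlmostEveryChannel (M + 2) 1 fun H => ∃ L : LinearScheme (M + 2) 1 1 (Fin 7),
      L.Decodable H ∧ L.Aligned H ∧ L.dof = 6 * (1 : ℕ) / 7 := by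
  refine exists_aligned_scheme_of_points (Nat.le_add_left 1 (M + 1)) le_rfl nullBeam
    (fun H j p n => ?_) (fun j p m => ?_) exists_single_receive_antenna_point
  · rw [Subsingleton.elim n 0]
    refine (sum_mul_nullBeam H j j p).trans ?_
    ring
  · simp only [nullBeam]
    refine (PolyFun _).sub_mem ?_ ?_ <;> split_ifs
    exacts [PolyFun.coord _, PolyFun.const _, PolyFun.coord _, PolyFun.const _]

end SingleReceiveAntenna

/-! ### Block codes with a given minimum distance -/

section GilbertVarshamov

variable {A : Type*} [Fintype A] [DecidableEq A] {n : ℕ}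

/-- A word of the ball is fixed by a set of at most `d` positions and its symbols there. Bounding
the number of sets by `2 ^ n` costs one bit per symbol, whatever the alphabet, which is negligible
as `P` grows. -/
theorem card_hammingBall_le [Nonempty A] (x : Fin n → A) (d : ℕ) :
    (Finset.univ.filter fun y : Fin n → A => hammingDist x y ≤ d).card ≤
      2 ^ n * Fintype.card A ^ d := by
  have hsub : (Finset.univ.filter fun y : Fin n → A => hammingDist x y ≤ d) ⊆
      (Finset.univ.filter fun J : Finset (Fin n) => J.card ≤ d).biUnion fun J =>
        Finset.univ.filter fun y => ∀ i ∉ J, x i = y i := by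
    intro y hy
    simp only [Finset.mem_filter, Finset.mem_univ, true_and] at hy
    simp only [Finset.mem_biUnion, Finset.mem_filter, Finset.mem_univ, true_and]
    exact ⟨Finset.univ.filter fun i => x i ≠ y i, hy, by simp⟩
  have hcard : ∀ J ∈ Finset.univ.filter fun J : Finset (Fin n) => J.card ≤ d,
      (Finset.univ.filter fun y : Fin n → A => ∀ i ∉ J, x i = y i).card ≤
        Fintype.card A ^ d := by
    intro J hJ
    simp only [Finset.mem_filter, Finset.mem_univ, true_and] at hJ
    calc _ ≤ (Finset.univ : Finset (J → A)).card := by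
          refine Finset.card_le_card_of_injOn (fun y i => y i) (by simp) ?_
          intro y hy y' hy' h
          simp only [Finset.coe_filter, Finset.mem_univ, true_and, Set.mem_ofPred_eq] at hy hy'
          ext i
          by_cases hi : i ∈ J
          · exact congrFun h ⟨i, hi⟩
          · rw [← hy i hi, ← hy' i hi]
      _ = Fintype.card A ^ J.card := by simp
      _ ≤ _ := Nat.pow_le_pow_right Fintype.card_pos hJ
  calc _ ≤ _ := Finset.card_le_card hsub
    _ ≤ _ := Finset.card_biUnion_le_card_mul _ _ _ hcard
    _ ≤ _ := by
        refine Nat.mul_le_mul_right _ ((Finset.card_filter_le _ _).trans ?_)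
        simp

/-- The Gilbert–Varshamov bound. -/
theorem exists_code_of_minDist [Nonempty A] (n d : ℕ) : ∃ C : Finset (Fin n → A),
    (∀ x ∈ C, ∀ y ∈ C, x ≠ y → d < hammingDist x y) ∧
      Fintype.card A ^ n ≤ C.card * (2 ^ n * Fintype.card A ^ d) := by
  classical
  obtain ⟨C, hC, hmax⟩ := Finset.exists_max_image (Finset.univ.filter fun C : Finset (Fin n → A) =>
    ∀ x ∈ C, ∀ y ∈ C, x ≠ y → d < hammingDist x y) Finset.card ⟨∅, by simp⟩
  simp only [Finset.mem_filter, Finset.mem_univ, true_and] at hC hmax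
  refine ⟨C, hC, ?_⟩
  have hcover : (Finset.univ : Finset (Fin n → A)) ⊆
      C.biUnion fun x => Finset.univ.filter fun y => hammingDist x y ≤ d := by
    intro y _
    by_contra hy
    simp only [Finset.mem_biUnion, Finset.mem_filter, Finset.mem_univ, true_and, not_exists,
      not_and, not_le] at hy
    have hyC : y ∉ C := fun h => by simpa using hy y h
    have := hmax (insert y C) ?_
    · rw [Finset.card_insert_of_notMem hyC] at this
      omega
    · intro a ha b hb hab
      rw [Finset.mem_insert] at ha hb
      rcases ha with rfl | ha <;> rcases hb with rfl | hb
      · exact absurd rfl hab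
      · rw [hammingDist_comm]; exact hy b hb
      · exact hy a ha
      · exact hC a ha b hb hab
  calc Fintype.card A ^ n = (Finset.univ : Finset (Fin n → A)).card := by simp
    _ ≤ _ := Finset.card_le_card hcover
    _ ≤ _ := Finset.card_biUnion_le_card_mul _ _ _ fun x _ => card_hammingBall_le x d

/-- The Gilbert–Varshamov bound for binary messages. -/
theorem exists_binary_encoder [Nonempty A] (n d : ℕ) :
    ∃ (B : ℕ) (f : Fin (2 ^ B) → Fin n → A), (∀ u v, u ≠ v → d < hammingDist (f u) (f v)) ∧
      ((n : ℝ) - d) * Real.logb 2 (Fintype.card A) - n - 1 ≤ B := by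
  obtain ⟨C, hC, hcard⟩ := exists_code_of_minDist (A := A) n d
  have hA : 0 < Fintype.card A := Fintype.card_pos
  have hCpos : 0 < C.card := by
    rcases Nat.eq_zero_or_pos C.card with h | h
    · rw [h, zero_mul] at hcard
      exact absurd hcard (not_le.2 (pow_pos hA n))
    · exact h
  refine ⟨Nat.log 2 C.card, ?_⟩
  have hle : Fintype.card (Fin (2 ^ Nat.log 2 C.card)) ≤ Fintype.card C := by
    simpa using Nat.pow_log_le_self 2 hCpos.ne'
  obtain ⟨g⟩ := Function.Embedding.nonempty_of_card_le hle
  refine ⟨fun u => (g u).1, fun u v huv => hC _ (g u).2 _ (g v).2 fun h =>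
    huv (g.injective (Subtype.ext h)), ?_⟩
  have h1 : (C.card : ℝ) ≤ 2 ^ (Nat.log 2 C.card + 1) := by
    exact_mod_cast (Nat.lt_pow_succ_log_self one_lt_two _).le
  have h2 : (Fintype.card A : ℝ) ^ n ≤
      2 ^ (Nat.log 2 C.card + 1) * (2 ^ n * (Fintype.card A : ℝ) ^ d) := by
    calc (Fintype.card A : ℝ) ^ n ≤ C.card * (2 ^ n * (Fintype.card A : ℝ) ^ d) := by
          exact_mod_cast hcard
      _ ≤ _ := by gcongr
  have hA' : (0 : ℝ) < Fintype.card A := by exact_mod_cast hA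
  have h3 := Real.logb_le_logb_of_le one_lt_two (by positivity) h2
  rw [Real.logb_mul (by positivity) (by positivity), Real.logb_mul (by positivity) (by positivity),
    Real.logb_pow, Real.logb_pow, Real.logb_pow, Real.logb_pow,
    Real.logb_self_eq_one one_lt_two] at h3
  push_cast at h3
  linarith

end GilbertVarshamov

/-! ### Noise -/

instance : IsProbabilityMeasure complexGaussian :=
  Measure.isProbabilityMeasure_map (MeasurableEquiv.measurable _).aemeasurable

theorem exists_noise_tail_le {ε : ℝ} (hε : 0 < ε) :
    ∃ D : ℝ, ∀ D' ≥ D, complexGaussian.real {z | D' ≤ ‖z‖} ≤ ε := by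
  have hms : ∀ D : ℝ, MeasurableSet {z : ℂ | D ≤ ‖z‖} := fun D =>
    measurableSet_le measurable_const measurable_norm
  have h : Tendsto (fun n : ℕ => complexGaussian {z : ℂ | (n : ℝ) ≤ ‖z‖}) atTop
      (𝓝 (complexGaussian (⋂ n : ℕ, {z : ℂ | (n : ℝ) ≤ ‖z‖}))) := by
    refine tendsto_measure_iInter_atTop (fun n => (hms n).nullMeasurableSet) ?_
      ⟨0, measure_ne_top _ _⟩
    intro m n hmn z hz
    exact le_trans (Nat.cast_le.2 hmn : (m : ℝ) ≤ n) hz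
  have he : (⋂ n : ℕ, {z : ℂ | (n : ℝ) ≤ ‖z‖}) = ∅ := by
    refine Set.eq_empty_of_forall_notMem fun z hz => ?_
    obtain ⟨n, hn⟩ := exists_nat_gt ‖z‖
    exact absurd (Set.mem_iInter.1 hz n) (not_le.2 hn)
  rw [he, measure_empty] at h
  obtain ⟨n, hn⟩ := ((tendsto_order.1 h).2 _ (ENNReal.ofReal_pos.2 hε)).exists
  refine ⟨n, fun D' hD' => ?_⟩
  have : complexGaussian {z : ℂ | D' ≤ ‖z‖} ≤ ENNReal.ofReal ε :=
    (measure_mono fun z hz => le_trans hD' hz).trans hn.le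
  exact ENNReal.toReal_le_of_le_ofReal hε.le this

/-- Union bound for the probability that many of finitely many i.i.d. events occur. -/
theorem pi_measureReal_card_gt_le {ι α : Type*} [Fintype ι] [MeasurableSpace α]
    (μ : Measure α) [IsProbabilityMeasure μ] (E : Set α) [∀ z : ι → α, DecidablePred (z · ∈ E)]
    (k : ℕ) :
    (Measure.pi fun _ : ι => μ).real {z | k < (Finset.univ.filter fun i => z i ∈ E).card} ≤
      2 ^ Fintype.card ι * μ.real E ^ (k + 1) := by
  classical
  have hsub : {z : ι → α | k < (Finset.univ.filter fun i => z i ∈ E).card} ⊆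
      ⋃ J ∈ Finset.powersetCard (k + 1) (Finset.univ : Finset ι), (J : Set ι).pi fun _ => E := by
    intro z hz
    obtain ⟨J, hJ, hJc⟩ := Finset.exists_subset_card_eq (Nat.succ_le_of_lt hz)
    simp only [Set.mem_iUnion]
    refine ⟨J, Finset.mem_powersetCard.2 ⟨Finset.subset_univ _, hJc⟩, fun i hi => ?_⟩
    simpa using hJ hi
  calc _ ≤ (Measure.pi fun _ : ι => μ).real _ := measureReal_mono hsub (measure_ne_top _ _)
    _ ≤ ∑ J ∈ Finset.powersetCard (k + 1) (Finset.univ : Finset ι),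
        (Measure.pi fun _ : ι => μ).real ((J : Set ι).pi fun _ => E) :=
        measureReal_biUnion_finset_le _ _
    _ = ∑ J ∈ Finset.powersetCard (k + 1) (Finset.univ : Finset ι), μ.real E ^ (k + 1) := by
        refine Finset.sum_congr rfl fun J hJ => ?_
        rw [Measure.real, Measure.pi_pi_finset, Finset.prod_const, (Finset.mem_powersetCard.1 hJ).2,
          ENNReal.toReal_pow]
        rfl
    _ ≤ _ := by
        rw [Finset.sum_const, nsmul_eq_mul, Finset.card_powersetCard, Finset.card_univ]
        gcongr
        exact_mod_cast Nat.choose_le_two_pow _ _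

/-! ### From separated constellations to achievable rates -/

section Modulation

variable {M N t : ℕ} {A : Type}

/-- A modulation of blocks of `t` channel uses: transmitter `p` maps one symbol for every receive
group to a block. -/
abbrev Modulation (M t : ℕ) (A : Type) : Type := Fin 3 → (RxGroup → A) → Fin t → Fin M → ℂ

/-- The noise-free block received by receiver `j`. -/
def Modulation.clean (x : Modulation M t A) (H : Channel M N) (j : Fin 3)
    (a : Fin 3 → RxGroup → A) (i : Fin t × Fin N) : ℂ :=
  ∑ p, (link H j p).mulVec (x p (a p) i.1) i.2

/-- At every receiver, blocks with different desired symbols differ by at least `D` in some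
coordinate. -/
def Modulation.Separated (x : Modulation M t A) (H : Channel M N) (D : ℝ) : Prop :=
  ∀ (j : Fin 3) (a a' : Fin 3 → RxGroup → A), (∃ (S : RxGroup) (p : Fin 3), j ∈ S.1 ∧
    a p S ≠ a' p S) → ∃ i, D ≤ ‖x.clean H j a i - x.clean H j a' i‖

/-- The transmitted blocks satisfy the power constraint. -/
def Modulation.PowerLE (x : Modulation M t A) (P : ℝ) : Prop :=
  ∀ p a τ, ∑ m, ‖x p a τ m‖ ^ 2 ≤ P

variable {T B : ℕ}

/-- The channel uses of the `b`-th block. -/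
def blockTime {n t T : ℕ} (h : n * t ≤ T) (b : Fin n) (τ : Fin t) : Fin T :=
  Fin.castLE h (finProdFinEquiv (b, τ))

theorem blockTime_injective {n t T : ℕ} (h : n * t ≤ T) :
    Function.Injective fun i : Fin n × Fin t => blockTime h i.1 i.2 :=
  (Fin.castLE_injective h).comp finProdFinEquiv.injective

/-- Transmitters encode their messages with the block code `f`, symbol by symbol, and modulate. -/
def blockEncode {n : ℕ} (x : Modulation M t A) (f : Fin (2 ^ B) → Fin n → A) (p : Fin 3)
    (w : RxGroup → Fin (2 ^ B)) (σ : Fin T) (m : Fin M) : ℂ :=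
  if h : (σ : ℕ) < n * t then
    x p (fun S => f (w S) (finProdFinEquiv.symm ⟨σ, h⟩).1) (finProdFinEquiv.symm ⟨σ, h⟩).2 m
  else 0

theorem blockEncode_blockTime {n : ℕ} (x : Modulation M t A) (f : Fin (2 ^ B) → Fin n → A)
    (p : Fin 3) (w : RxGroup → Fin (2 ^ B)) (h : n * t ≤ T) (b : Fin n) (τ : Fin t) :
    blockEncode x f p w (blockTime h b τ) = x p (fun S => f (w S) b) τ := by
  ext m
  have h1 : ((blockTime h b τ : Fin T) : ℕ) < n * t := (finProdFinEquiv (b, τ)).2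
  have h2 : (⟨(blockTime h b τ : Fin T), h1⟩ : Fin (n * t)) = finProdFinEquiv (b, τ) := rfl
  rw [blockEncode, dif_pos h1, h2, Equiv.symm_apply_apply]

open Classical in
/-- Choose some element satisfying a predicate if there is one. -/
def pick {α : Type*} [Nonempty α] (Q : α → Prop) : α :=
  if h : ∃ a, Q a then h.choose else Classical.arbitrary α

theorem pick_spec {α : Type*} [Nonempty α] {Q : α → Prop} (h : ∃ a, Q a) : Q (pick Q) := by
  rw [pick, dif_pos h]; exact h.choose_spec

/-- The blocks that are close to the received one. -/
def closeBlocks {n : ℕ} (x : Modulation M t A) (H : Channel M N) (D : ℝ) (h : n * t ≤ T)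
    (j : Fin 3) (y : Fin T × Fin N → ℂ) (b : Fin n) (a : Fin 3 → RxGroup → A) : Prop :=
  ∀ i : Fin t × Fin N, ‖y (blockTime h b i.1, i.2) - x.clean H j a i‖ < D / 2

theorem measurable_closeBlocks {n : ℕ} (x : Modulation M t A) (H : Channel M N) (D : ℝ)
    (h : n * t ≤ T) (j : Fin 3) : Measurable (closeBlocks x H D h j) := by
  refine measurable_pi_iff.2 fun b => measurable_pi_iff.2 fun a => ?_
  refine Measurable.forall fun i => measurableSet_setOfPred.1 (measurableSet_lt ?_ measurable_const)
  exact ((measurable_pi_apply _).sub_const _).norm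

/-- Estimate the symbols from the close blocks, and the messages from the symbols by minimum
distance decoding. -/
def decodeClose {n : ℕ} [Nonempty A] [DecidableEq A] (f : Fin (2 ^ B) → Fin n → A) (k : ℕ)
    (Q : Fin n → (Fin 3 → RxGroup → A) → Prop) (S : RxGroup) (p : Fin 3) : Fin (2 ^ B) :=
  pick fun u => hammingDist (f u) (fun b => pick (Q b) p S) ≤ k

/-- The code that combines a block code with a modulation. -/
def blockCode {n : ℕ} [Fintype A] [Nonempty A] [DecidableEq A] (x : Modulation M t A)
    (f : Fin (2 ^ B) → Fin n → A) (H : Channel M N) (D : ℝ) (h : n * t ≤ T) (k : ℕ) :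
    Code M N T B where
  enc := blockEncode x f
  dec j y S p := decodeClose f k (closeBlocks x H D h j y) S.1 p
  -- The decoder depends on the received signal only through finitely many propositions, so the
  -- arbitrary choices in `pick` cannot destroy measurability.
  measurable_dec j := (Measurable.of_discrete (f := fun Q (S : {S : RxGroup // j ∈ S.1}) p =>
    decodeClose f k Q S.1 p)).comp (measurable_closeBlocks x H D h j)

/-- In a block where all noise entries are below `D / 2` the sent symbols are close, and by
separation every close candidate has the same desired symbols. Each wrong block contains its own
large noise entry, so at most `k` symbols are wrong, which a distance above `2 * k` corrects. -/
theorem blockCode_correct {n : ℕ} [NeZero t] [NeZero N] [Fintype A] [Nonempty A] [DecidableEq A] {x : Modulation M t A}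
    {f : Fin (2 ^ B) → Fin n → A} {H : Channel M N} {D : ℝ} {h : n * t ≤ T} {k : ℕ}
    (hx : x.Separated H D) (hf : ∀ u v, u ≠ v → 2 * k < hammingDist (f u) (f v))
    (j : Fin 3) (w : Messages B) (z : Fin T × Fin N → ℂ)
    (hz : (Finset.univ.filter fun i => D / 2 ≤ ‖z i‖).card ≤ k)
    (S : {S : RxGroup // j ∈ S.1}) (p : Fin 3) :
    (blockCode x f H D h k).dec j ((blockCode x f H D h k).received H j w z) S p = w p S.1 := by
  set y := (blockCode x f H D h k).received H j w z with hy
  set Q := closeBlocks x H D h j y with hQ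
  have hrec : ∀ b i, y (blockTime h b i.1, i.2) =
      x.clean H j (fun p S => f (w p S) b) i + z (blockTime h b i.1, i.2) := by
    intro b i
    simp only [hy, Code.received, Modulation.clean]
    congr 1
    refine Finset.sum_congr rfl fun q _ => ?_
    change (link H j q).mulVec (blockEncode x f q (w q) _) _ = _
    rw [blockEncode_blockTime]
  have hgood : ∀ b, (∀ i : Fin t × Fin N, ‖z (blockTime h b i.1, i.2)‖ < D / 2) →
      f (w p S.1) b = pick (Q b) p S.1 := by
    intro b hb
    by_contra hne
    have hex : ∃ a, Q b a := ⟨fun p S => f (w p S) b, fun i => by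
      rw [hrec]; simpa using hb i⟩
    have hspec := pick_spec hex
    obtain ⟨i, hi⟩ := hx j (fun p S => f (w p S) b) (pick (Q b)) ⟨S.1, p, S.2, hne⟩
    have h1 := hspec i
    have h2 := hb i
    rw [hrec] at h1
    have h3 : x.clean H j (fun p S => f (w p S) b) i - x.clean H j (pick (Q b)) i =
        (x.clean H j (fun p S => f (w p S) b) i + z (blockTime h b i.1, i.2) -
          x.clean H j (pick (Q b)) i) - z (blockTime h b i.1, i.2) := by ring
    rw [h3] at hi
    have := norm_sub_le (x.clean H j (fun p S => f (w p S) b) i + z (blockTime h b i.1, i.2) -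
          x.clean H j (pick (Q b)) i) (z (blockTime h b i.1, i.2))
    linarith
  have hdist : hammingDist (f (w p S.1)) (fun b => pick (Q b) p S.1) ≤ k := by
    refine le_trans ?_ hz
    have hbad : ∀ b, f (w p S.1) b ≠ pick (Q b) p S.1 →
        ∃ i : Fin t × Fin N, D / 2 ≤ ‖z (blockTime h b i.1, i.2)‖ := by
      intro b hb
      by_contra! hcon
      exact hb (hgood b hcon)
    choose! g hg using hbad
    refine Finset.card_le_card_of_injOn (fun b => (blockTime h b (g b).1, (g b).2)) ?_ ?_
    · intro b hb
      simpa using hg b (by simpa using hb)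
    · intro b _ b' _ hbb
      have := @blockTime_injective n t T h (b, (g b).1) (b', (g b').1) (Prod.mk.inj hbb).1
      exact (Prod.mk.inj this).1
  have hspec : hammingDist (f (pick fun u => hammingDist (f u)
      (fun b => pick (Q b) p S.1) ≤ k)) (fun b => pick (Q b) p S.1) ≤ k :=
    pick_spec (Q := fun u => hammingDist (f u) (fun b => pick (Q b) p S.1) ≤ k) ⟨_, hdist⟩
  by_contra hne
  have h1 := hf _ _ hne
  have h2 := hammingDist_triangle_right (f (pick fun u => hammingDist (f u)
      (fun b => pick (Q b) p S.1) ≤ k)) (f (w p S.1)) (fun b => pick (Q b) p S.1)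
  change 2 * k < hammingDist (f (pick fun u => hammingDist (f u)
      (fun b => pick (Q b) p S.1) ≤ k)) (f (w p S.1)) at h1
  omega

theorem blockCode_powerLE {n : ℕ} [Fintype A] [Nonempty A] [DecidableEq A] [NeZero t]
    {x : Modulation M t A} {P : ℝ} (hx : x.PowerLE P) (f : Fin (2 ^ B) → Fin n → A)
    (H : Channel M N) (D : ℝ) (h : n * t ≤ T) (k : ℕ) : (blockCode x f H D h k).PowerLE P := by
  intro p w σ
  by_cases hσ : (σ : ℕ) < n * t
  · simp only [blockCode, blockEncode, dif_pos hσ]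
    exact hx _ _ _
  · simp only [blockCode, blockEncode, dif_neg hσ]
    refine le_trans ?_ (hx 0 (fun _ => Classical.arbitrary A) 0)
    simpa using Finset.sum_nonneg fun m _ => by positivity

instance : IsProbabilityMeasure (noise T N) := by
  unfold noise; infer_instance

theorem blockCode_errorProb_le {n : ℕ} [NeZero t] [NeZero N] [Fintype A] [Nonempty A]
    [DecidableEq A] {x : Modulation M t A}
    {f : Fin (2 ^ B) → Fin n → A} {H : Channel M N} {D : ℝ} {h : n * t ≤ T} {k : ℕ}
    (hx : x.Separated H D) (hf : ∀ u v, u ≠ v → 2 * k < hammingDist (f u) (f v)) (j : Fin 3) :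
    (blockCode x f H D h k).errorProb H j ≤
      2 ^ (T * N) * complexGaussian.real {z | D / 2 ≤ ‖z‖} ^ (k + 1) := by
  have hpos : (0 : ℝ) < Fintype.card (Messages B) := by exact_mod_cast Fintype.card_pos
  rw [Code.errorProb, div_le_iff₀ hpos, mul_comm, ← nsmul_eq_mul, ← Finset.card_univ]
  refine Finset.sum_le_card_nsmul _ _ _ fun w _ => ?_
  have := pi_measureReal_card_gt_le (ι := Fin T × Fin N) complexGaussian {z : ℂ | D / 2 ≤ ‖z‖} k
  rw [Fintype.card_prod, Fintype.card_fin, Fintype.card_fin] at this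
  refine le_trans (measureReal_mono (fun z hz => ?_) (measure_ne_top _ _)) this
  obtain ⟨S, p, hne⟩ := hz
  by_contra hcon
  exact hne (blockCode_correct hx hf j w z (not_lt.1 hcon) S p)

/-- A separated modulation supports the rate of its symbols, up to a loss that is small if errors of
the symbols are rare. -/
theorem achievableRate_of_separated {A : Type} [Fintype A] [Nonempty A] [NeZero t] [NeZero N]
    {H : Channel M N} {x : Modulation M t A} {P D : ℝ} (hP : x.PowerLE P) (hx : x.Separated H D)
    {L : ℕ} (hL : 0 < L)
    (hD : complexGaussian.real {z | D / 2 ≤ ‖z‖} ≤ (1 / 2) ^ ((N + 1) * L)) :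
    AchievableRate H P (6 * ((1 / t - 3 / L) * Real.logb 2 (Fintype.card A) - 2)) := by
  classical
  intro ε hε
  have ht : 0 < t := Nat.pos_of_ne_zero (NeZero.ne t)
  have hlim : ∀ᶠ T : ℕ in atTop, ((1 : ℝ) / 2) ^ T ≤ ε :=
    (tendsto_pow_atTop_nhds_zero_of_lt_one (by norm_num) (by norm_num)).eventually_le_const hε
  filter_upwards [hlim, eventually_ge_atTop L] with T hT hTL
  -- Correcting `T / L` errors costs `2 * T / L` symbols. Rounding `T / t` costs one more symbol,
  -- absorbed by a third `T / L ≥ 1`; the remaining loss `T / t + 1 ≤ 2 * T` bits is the final `- 2`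
  -- in the rate.
  obtain ⟨B, f, hf, hB⟩ := exists_binary_encoder (A := A) (T / t) (2 * (T / L))
  have hn : T / t * t ≤ T := Nat.div_mul_le_self T t
  refine ⟨B, blockCode x f H D hn (T / L), ?_, blockCode_powerLE hP f H D hn _, fun j => ?_⟩
  · have hq : 0 ≤ Real.logb 2 (Fintype.card A) :=
      Real.logb_nonneg one_lt_two (by exact_mod_cast Fintype.card_pos)
    have hT0 : (0 : ℝ) < T := by exact_mod_cast hL.trans_le hTL
    have ht' : (0 : ℝ) < t := by exact_mod_cast ht
    have hL' : (0 : ℝ) < L := by exact_mod_cast hL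
    have h1 : (T : ℝ) / t - 1 ≤ ((T / t : ℕ) : ℝ) := by
      have : (T : ℝ) / t < ((T / t : ℕ) : ℝ) + 1 := by
        rw [div_lt_iff₀ ht', mul_comm]
        exact_mod_cast Nat.lt_mul_div_succ T ht
      linarith
    have h2 : ((T / t : ℕ) : ℝ) ≤ T := by exact_mod_cast Nat.div_le_self _ _
    have h3 : ((T / L : ℕ) : ℝ) ≤ T / L := Nat.cast_div_le
    have h4 : (1 : ℝ) ≤ T / L := by rw [le_div_iff₀ hL']; simpa using (by exact_mod_cast hTL)
    have h5 : (1 : ℝ) ≤ T := by exact_mod_cast (Nat.one_le_iff_ne_zero.2 (by omega))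
    have h6 : ((T : ℝ) / t - 3 * (T / L)) * Real.logb 2 (Fintype.card A) ≤
        (((T / t : ℕ) : ℝ) - (2 * (T / L) : ℕ)) * Real.logb 2 (Fintype.card A) := by
      refine mul_le_mul_of_nonneg_right ?_ hq
      push_cast
      linarith
    have h7 : 6 * ((1 / t - 3 / L) * Real.logb 2 (Fintype.card A) - 2) * (T : ℝ) =
        6 * (((T : ℝ) / t - 3 * (T / L)) * Real.logb 2 (Fintype.card A) - 2 * T) := by ring
    rw [h7]
    linarith
  · refine (blockCode_errorProb_le hx hf j).trans (le_trans ?_ hT)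
    have h1 : T ≤ L * (T / L + 1) := (Nat.lt_mul_div_succ T hL).le
    -- The exponent `(N + 1) * L` beats the `2 ^ (T * N)` patterns of large noise and leaves `(1 /
    -- 2) ^ T`.
    calc (2 : ℝ) ^ (T * N) * complexGaussian.real {z | D / 2 ≤ ‖z‖} ^ (T / L + 1)
        ≤ 2 ^ (T * N) * ((1 / 2) ^ ((N + 1) * L)) ^ (T / L + 1) := by gcongr
      _ = 2 ^ (T * N) * (1 / 2) ^ ((N + 1) * (L * (T / L + 1))) := by
          rw [← pow_mul, mul_assoc]
      _ ≤ 2 ^ (T * N) * (1 / 2) ^ ((N + 1) * T) := by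
          gcongr ?_ * ?_
          exact pow_le_pow_of_le_one (by norm_num) (by norm_num) (Nat.mul_le_mul_left _ h1)
      _ = (1 / 2) ^ T := by
          rw [add_mul, one_mul, pow_add, ← mul_assoc, mul_comm T N, ← mul_pow]
          norm_num

end Modulation

/-- The degrees of freedom `d` are achievable if rates `(d - η) * log P` are achievable for
every positive `η`. -/
theorem achievableDoF_of_forall_pos {M N : ℕ} {H : Channel M N} {d : ℝ}
    (h : ∀ η : ℝ, 0 < η → ∀ᶠ P in atTop, AchievableRate H P ((d - η) * Real.logb 2 P)) :
    AchievableDoF H d := by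
  classical
  let Q : ℝ → ℕ → Prop := fun P n => AchievableRate H P ((d - 1 / ((n : ℝ) + 1)) * Real.logb 2 P)
  have hQ : ∀ n, ∀ᶠ P in atTop, Q P n := fun n => h _ Nat.one_div_pos_of_nat
  -- A diagonal choice: the best index not exceeding `P` that works at power `P`. It tends to
  -- infinity since every fixed index works eventually.
  let g : ℝ → ℕ := fun P => Nat.findGreatest (Q P) ⌊P⌋₊
  refine ⟨fun P => (d - 1 / ((g P : ℝ) + 1)) * Real.logb 2 P, ?_, ?_⟩
  · filter_upwards [hQ 0] with P hP
    exact Nat.findGreatest_spec (P := Q P) (Nat.zero_le _) hP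
  · have hg : Tendsto g atTop atTop := by
      refine tendsto_atTop.2 fun n => ?_
      filter_upwards [hQ n, eventually_ge_atTop (n : ℝ)] with P hP hn
      exact Nat.le_findGreatest (Nat.le_floor hn) hP
    have h1 : Tendsto (fun P => d - 1 / ((g P : ℝ) + 1)) atTop (𝓝 (d - 0)) :=
      tendsto_const_nhds.sub (tendsto_one_div_add_atTop_nhds_zero_nat.comp hg)
    rw [sub_zero] at h1
    refine h1.congr' ?_
    filter_upwards [eventually_gt_atTop 1] with P hP
    rw [mul_div_cancel_right₀ _ (Real.logb_pos one_lt_two hP).ne']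

theorem AchievableRate.mono {M N : ℕ} {H : Channel M N} {P R R' : ℝ} (h : AchievableRate H P R)
    (hR : R' ≤ R) : AchievableRate H P R' := fun ε hε => by
  filter_upwards [h ε hε] with T ⟨B, c, hB, hc⟩
  exact ⟨B, c, le_trans (by gcongr) hB, hc⟩

/-! ### Linear precoding of integer constellations -/

section Linear

variable {M N s t : ℕ}

/-- The matrix through which receiver `j` sees the symbols of the message `(S, p)` on all of its
antennas. -/
def precodedLink (V : RxGroup → Fin 3 → Matrix (Fin t × Fin M) (Fin s) ℂ) (H : Channel M N)
    (j : Fin 3) (S : RxGroup) (p : Fin 3) : Matrix (Fin t × Fin N) (Fin s) ℂ :=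
  Matrix.of fun i c => ∑ m, H (j, p, i.2, m) * V S p (i.1, m) c

/-- The Gaussian integers with real and imaginary part less than `Q` in absolute value. -/
def gaussianBox (Q : ℕ) : Set ℂ :=
  {z | ∃ u v : ℤ, |u| < Q ∧ |v| < Q ∧ z = u + v * Complex.I}

/-- Points of a square constellation. -/
def squarePoint {Q : ℕ} (a : Fin Q × Fin Q) : ℂ := (a.1 : ℕ) + (a.2 : ℕ) * Complex.I

theorem squarePoint_injective {Q : ℕ} : Function.Injective (squarePoint (Q := Q)) := by
  intro a b h
  have h1 := congrArg Complex.re h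
  have h2 := congrArg Complex.im h
  simp [squarePoint] at h1 h2
  exact Prod.ext (Fin.ext h1) (Fin.ext h2)

theorem squarePoint_sub_mem {Q : ℕ} (a b : Fin Q × Fin Q) :
    squarePoint a - squarePoint b ∈ gaussianBox Q := by
  refine ⟨(a.1 : ℕ) - (b.1 : ℕ), (a.2 : ℕ) - (b.2 : ℕ), ?_, ?_, ?_⟩
  · rw [abs_lt]; omega
  · rw [abs_lt]; omega
  · simp only [squarePoint]; push_cast; ring

theorem norm_squarePoint_le {Q : ℕ} (a : Fin Q × Fin Q) : ‖squarePoint a‖ ≤ 2 * Q := by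
  refine (norm_add_le _ _).trans ?_
  rw [norm_mul, Complex.norm_I, mul_one, Complex.norm_natCast, Complex.norm_natCast, two_mul]
  exact add_le_add (by exact_mod_cast a.1.2.le) (by exact_mod_cast a.2.2.le)

/-- Linear precoding of square constellations, with amplitude `α`. -/
def linearModulation (V : RxGroup → Fin 3 → Matrix (Fin t × Fin M) (Fin s) ℂ) (α : ℝ) (Q : ℕ) :
    Modulation M t (Fin s → Fin Q × Fin Q) :=
  fun p a τ m => α * ∑ S, (V S p).mulVec (fun c => squarePoint (a S c)) (τ, m)

theorem linearModulation_clean_sub (V : RxGroup → Fin 3 → Matrix (Fin t × Fin M) (Fin s) ℂ) (α : ℝ)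
    (Q : ℕ) (H : Channel M N) (j : Fin 3) (a a' : Fin 3 → RxGroup → Fin s → Fin Q × Fin Q)
    (i : Fin t × Fin N) :
    (linearModulation V α Q).clean H j a i - (linearModulation V α Q).clean H j a' i =
      α * ∑ S, ∑ p, (precodedLink V H j S p).mulVec
        (fun c => squarePoint (a p S c) - squarePoint (a' p S c)) i := by
  have h : ∀ a : Fin 3 → RxGroup → Fin s → Fin Q × Fin Q,
      (linearModulation V α Q).clean H j a i = α * ∑ S, ∑ p, (precodedLink V H j S p).mulVec
        (fun c => squarePoint (a p S c)) i := by
    intro a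
    rw [Finset.sum_comm, Finset.mul_sum, Modulation.clean]
    refine Finset.sum_congr rfl fun p _ => ?_
    simp only [linearModulation, Matrix.mulVec, dotProduct, link, precodedLink, Matrix.of_apply,
      Finset.mul_sum, Finset.sum_mul]
    rw [Finset.sum_comm]
    refine Finset.sum_congr rfl fun S _ => ?_
    rw [Finset.sum_comm]
    refine Finset.sum_congr rfl fun c _ => Finset.sum_congr rfl fun m _ => ?_
    ring
  rw [h, h, ← mul_sub, ← Finset.sum_sub_distrib]
  congr 1
  refine Finset.sum_congr rfl fun S _ => ?_
  rw [← Finset.sum_sub_distrib]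
  refine Finset.sum_congr rfl fun p _ => ?_
  rw [← Pi.sub_apply, ← Matrix.mulVec_sub]
  rfl

theorem exists_linearModulation_norm_le (V : RxGroup → Fin 3 → Matrix (Fin t × Fin M) (Fin s) ℂ) :
    ∃ C : ℝ, 0 < C ∧ ∀ (P : ℝ) (Q : ℕ), 0 ≤ P → 0 < Q →
      (linearModulation V (√P / (C * Q)) Q).PowerLE P := by
  let C₀ : ℝ := 1 + ∑ p, ∑ S, ∑ i, ∑ c, ‖V S p i c‖ * 2
  have hC₀ : 0 < C₀ := by positivity
  refine ⟨C₀ * (M + 1), by positivity, fun P Q hP hQ p a τ => ?_⟩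
  have hQ' : (0 : ℝ) < Q := by exact_mod_cast hQ
  have hb : ∀ m, ‖linearModulation V (√P / (C₀ * (M + 1) * Q)) Q p a τ m‖ ≤ √P / (M + 1) := by
    intro m
    have h1 : ‖∑ S, (V S p).mulVec (fun c => squarePoint (a S c)) (τ, m)‖ ≤ C₀ * Q := by
      calc _ ≤ ∑ S, ∑ c, ‖V S p (τ, m) c‖ * (2 * Q) := by
            refine norm_sum_le_of_le _ fun S _ => ?_
            rw [Matrix.mulVec, dotProduct]
            refine norm_sum_le_of_le _ fun c _ => ?_
            rw [norm_mul]
            gcongr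
            exact norm_squarePoint_le _
        _ = (∑ S, ∑ c, ‖V S p (τ, m) c‖ * 2) * Q := by
            simp only [Finset.sum_mul, mul_assoc]
        _ ≤ _ := by
            refine mul_le_mul_of_nonneg_right ?_ hQ'.le
            calc _ ≤ ∑ S, ∑ i, ∑ c, ‖V S p i c‖ * 2 := Finset.sum_le_sum fun S _ =>
                  Finset.single_le_sum (f := fun i => ∑ c, ‖V S p i c‖ * 2)
                    (fun i _ => by positivity) (Finset.mem_univ (τ, m))
              _ ≤ ∑ p, ∑ S, ∑ i, ∑ c, ‖V S p i c‖ * 2 :=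
                  Finset.single_le_sum (f := fun p => ∑ S, ∑ i, ∑ c, ‖V S p i c‖ * 2)
                    (fun i _ => by positivity) (Finset.mem_univ p)
              _ ≤ C₀ := by simp only [C₀]; linarith
    rw [linearModulation, norm_mul, Complex.norm_real, Real.norm_of_nonneg (by positivity)]
    calc _ ≤ √P / (C₀ * (M + 1) * Q) * (C₀ * Q) := by gcongr
      _ = √P / (M + 1) := by field_simp
  calc _ ≤ ∑ m : Fin M, (√P / (M + 1)) ^ 2 := by
        refine Finset.sum_le_sum fun m _ => ?_
        gcongr
        exact hb m
    _ = M / (M + 1) ^ 2 * P := by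
        rw [Finset.sum_const, Finset.card_univ, Fintype.card_fin, nsmul_eq_mul, div_pow,
          Real.sq_sqrt hP]
        ring
    _ ≤ 1 * P := by
        gcongr
        rw [div_le_one (by positivity)]
        have : (0 : ℝ) ≤ M := Nat.cast_nonneg M
        nlinarith
    _ = P := one_mul P

/-- The received constellation for square constellations of size `Q` has minimum distance at
least `r`. -/
def MinDistGE (V : RxGroup → Fin 3 → Matrix (Fin t × Fin M) (Fin s) ℂ) (H : Channel M N) (Q : ℕ)
    (r : ℝ) : Prop :=
  ∀ (j : Fin 3) (Δ : RxGroup → Fin 3 → Fin s → ℂ), (∀ S p c, Δ S p c ∈ gaussianBox Q) →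
    (∃ S p, j ∈ S.1 ∧ Δ S p ≠ 0) →
    ∃ i, r ≤ ‖∑ S, ∑ p, (precodedLink V H j S p).mulVec (Δ S p) i‖

theorem linearModulation_separated {V : RxGroup → Fin 3 → Matrix (Fin t × Fin M) (Fin s) ℂ}
    {H : Channel M N} {Q : ℕ} {r α : ℝ} (h : MinDistGE V H Q r) (hα : 0 ≤ α) :
    (linearModulation V α Q).Separated H (α * r) := by
  rintro j a a' ⟨S, p, hj, hne⟩
  obtain ⟨i, hi⟩ := h j (fun S p c => squarePoint (a p S c) - squarePoint (a' p S c))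
    (fun S p c => squarePoint_sub_mem _ _) ⟨S, p, hj, fun h0 => hne (funext fun c =>
      squarePoint_injective (sub_eq_zero.1 (congrFun h0 c)))⟩
  refine ⟨i, ?_⟩
  rw [linearModulation_clean_sub, norm_mul, Complex.norm_real, Real.norm_of_nonneg hα]
  gcongr

/-- Half of the exponent beats the logarithm, the other half the constant. -/
theorem eventually_rpow_div_log_ge {r : ℝ} (hr : 0 < r) (K : ℝ) :
    ∀ᶠ P : ℝ in atTop, K * (Real.logb 2 P + 1) ≤ P ^ r := by
  have h2 : 0 < r / 2 := by positivity
  have hlog : 0 < Real.log 2 := Real.log_pos one_lt_two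
  have h1 := (isLittleO_log_rpow_atTop h2).bound (show 0 < Real.log 2 by positivity)
  filter_upwards [h1, eventually_ge_atTop 1,
    (tendsto_rpow_atTop h2).eventually_ge_atTop (2 * |K|)] with P hP hP1 hK
  have hP0 : 0 < P := by linarith
  have hone : 1 ≤ P ^ (r / 2) := Real.one_le_rpow hP1 h2.le
  rw [Real.norm_of_nonneg (Real.log_nonneg hP1), Real.norm_of_nonneg (by positivity)] at hP
  have h3 : Real.logb 2 P ≤ P ^ (r / 2) := by
    rw [Real.logb, div_le_iff₀ hlog]; linarith
  have h0 : 0 ≤ Real.logb 2 P := Real.logb_nonneg one_lt_two hP1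
  calc K * (Real.logb 2 P + 1) ≤ |K| * (Real.logb 2 P + 1) := by
        gcongr
        exact le_abs_self K
    _ ≤ |K| * (2 * P ^ (r / 2)) := by gcongr; linarith
    _ = 2 * |K| * P ^ (r / 2) := by ring
    _ ≤ P ^ (r / 2) * P ^ (r / 2) := by gcongr
    _ = P ^ r := by rw [← Real.rpow_add hP0]; ring_nf

/-- Degrees of freedom of linearly precoded integer constellations whose minimum distance at the
receivers decays like the power `κ` of their size. -/
theorem achievableDoF_of_minDistGE [NeZero t] [NeZero N]
    {V : RxGroup → Fin 3 → Matrix (Fin t × Fin M) (Fin s) ℂ} {H : Channel M N} {κ : ℕ} {c : ℝ}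
    (hc : 0 < c) (h : ∀ᶠ n : ℕ in atTop, MinDistGE V H (2 ^ n) (c / (2 ^ (κ * n) * (n + 1)))) :
    AchievableDoF H (6 * s / (t * (1 + κ))) := by
  have ht : (0 : ℝ) < t := by exact_mod_cast Nat.pos_of_ne_zero (NeZero.ne t)
  refine achievableDoF_of_forall_pos fun η hη => ?_
  obtain ⟨C, hC, hpow⟩ := exists_linearModulation_norm_le V
  -- the loss in the outer code and in the size of the constellation
  obtain ⟨L, hL, hLt, hcoef⟩ : ∃ L : ℕ, 1 < L ∧ 3 * t ≤ L ∧
      6 * s / (t * (1 + κ)) - η / 2 ≤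
        6 * ((1 / (t : ℝ) - 3 * (1 / (L : ℝ))) * (2 * s * ((1 - 1 / L) / (2 * (1 + κ))))) := by
    have h1 : Tendsto (fun L : ℕ => 6 * ((1 / (t : ℝ) - 3 * (1 / (L : ℝ))) *
        (2 * s * ((1 - 1 / L) / (2 * (1 + κ)))))) atTop
        (𝓝 (6 * ((1 / (t : ℝ) - 3 * 0) * (2 * s * ((1 - 0) / (2 * (1 + (κ : ℝ)))))))) := by
      have h0 := tendsto_one_div_atTop_nhds_zero_nat (𝕜 := ℝ)
      exact ((tendsto_const_nhds.sub (h0.const_mul 3)).mul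
        (((tendsto_const_nhds.sub h0).div_const _).const_mul _)).const_mul 6
    have h2 : 6 * ((1 / (t : ℝ) - 3 * 0) * (2 * s * ((1 - 0) / (2 * (1 + (κ : ℝ)))))) =
        6 * s / (t * (1 + κ)) := by field_simp; ring
    rw [h2] at h1
    obtain ⟨L, hL⟩ := ((h1.eventually_const_le
      (show 6 * s / (t * (1 + κ)) - η / 2 < 6 * s / (t * (1 + (κ : ℝ))) by linarith)).and
      (eventually_ge_atTop (2 + 3 * t))).exists
    exact ⟨L, by omega, by omega, hL.1⟩
  have hL0 : (0 : ℝ) < L := by exact_mod_cast (by omega : 0 < L)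
  have hL1 : (1 : ℝ) / L < 1 := by rw [div_lt_one hL0]; exact_mod_cast hL
  -- The constellation size is `Q`, about `P ^ β`. Amplitude `√P / Q` times distance `Q ^ (-κ)` is
  -- then at least about `P ^ (1 / (2 * L))`, which outgrows the factor `n + 1` and all constants.
  set β : ℝ := (1 - 1 / L) / (2 * (1 + κ)) with hβ
  have hβ0 : 0 < β := div_pos (by linarith) (by positivity)
  have hβ1 : β ≤ 1 := by
    rw [hβ, div_le_one (by positivity)]
    have : 0 ≤ 1 / (L : ℝ) := by positivity
    have : (0 : ℝ) ≤ κ := Nat.cast_nonneg κ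
    linarith
  have hβκ : β * (κ + 1) = 1 / 2 - 1 / (2 * L) := by
    rw [hβ]; field_simp
    ring
  obtain ⟨D₀, hD₀⟩ := exists_noise_tail_le (ε := (1 / 2) ^ ((N + 1) * L)) (by positivity)
  let n : ℝ → ℕ := fun P => ⌊β * Real.logb 2 P⌋₊
  have hlog : Tendsto (Real.logb 2) atTop atTop := Real.tendsto_logb_atTop one_lt_two
  have hn : Tendsto n atTop atTop := tendsto_nat_floor_atTop.comp (hlog.const_mul_atTop hβ0)
  set G : ℝ := 1 / (t : ℝ) - 3 * (1 / (L : ℝ)) with hG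
  have hG0 : 0 ≤ G := by
    rw [hG, sub_nonneg, mul_one_div, div_le_div_iff₀ hL0 ht, one_mul]
    exact_mod_cast hLt
  filter_upwards [hn.eventually h, eventually_ge_atTop 1,
    eventually_rpow_div_log_ge (r := 1 / (2 * L)) (by positivity) (|2 * D₀ * C / c|),
    hlog.eventually_ge_atTop ((12 * G * s + 12) / (η / 2))] with P hmin hP1 hPlog hPη
  have hP0 : 0 < P := by linarith
  have hlog0 : 0 ≤ Real.logb 2 P := Real.logb_nonneg one_lt_two hP1
  have hfl : (n P : ℝ) ≤ β * Real.logb 2 P := Nat.floor_le (by positivity)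
  have hfl' : β * Real.logb 2 P - 1 < n P := Nat.sub_one_lt_floor _
  have hQ : 0 < 2 ^ n P := by positivity
  let Q : ℕ := 2 ^ n P
  have hsep := linearModulation_separated hmin (α := √P / (C * Q)) (by positivity)
  have hpw : (linearModulation V (√P / (C * Q)) Q).PowerLE P := hpow P Q hP0.le hQ
  have hD : D₀ ≤ √P / (C * Q) * (c / (2 ^ (κ * n P) * (n P + 1))) / 2 := by
    have h1 : ((2 : ℝ) ^ n P) ^ (κ + 1) ≤ P ^ (1 / 2 - 1 / (2 * (L : ℝ))) := by
      rw [← hβκ, ← pow_mul, ← Real.rpow_natCast 2]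
      calc (2 : ℝ) ^ ((n P * (κ + 1) : ℕ) : ℝ) ≤ 2 ^ (Real.logb 2 P * (β * (κ + 1))) := by
            refine Real.rpow_le_rpow_of_exponent_le one_le_two ?_
            push_cast
            calc (n P : ℝ) * (κ + 1) ≤ β * Real.logb 2 P * (κ + 1) := by gcongr
              _ = _ := by ring
        _ = P ^ (β * (κ + 1)) := by
            rw [Real.rpow_mul zero_le_two, Real.rpow_logb two_pos (by norm_num) hP0]
    have h2 : (n P : ℝ) + 1 ≤ Real.logb 2 P + 1 := by
      have : β * Real.logb 2 P ≤ 1 * Real.logb 2 P := by gcongr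
      linarith
    have h3 : √P = P ^ (1 / 2 - 1 / (2 * (L : ℝ))) * P ^ (1 / (2 * (L : ℝ))) := by
      rw [← Real.rpow_add hP0, Real.sqrt_eq_rpow]; ring_nf
    have h4 : 2 * D₀ * C / c * (((2 : ℝ) ^ n P) ^ (κ + 1) * (n P + 1)) ≤ √P := by
      calc 2 * D₀ * C / c * (((2 : ℝ) ^ n P) ^ (κ + 1) * (n P + 1))
          ≤ |2 * D₀ * C / c| * (P ^ (1 / 2 - 1 / (2 * (L : ℝ))) * (Real.logb 2 P + 1)) := by
            gcongr
            exact le_abs_self _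
        _ = P ^ (1 / 2 - 1 / (2 * (L : ℝ))) * (|2 * D₀ * C / c| * (Real.logb 2 P + 1)) := by
            ring
        _ ≤ P ^ (1 / 2 - 1 / (2 * (L : ℝ))) * P ^ (1 / (2 * (L : ℝ))) := by gcongr
        _ = √P := h3.symm
    have h5 : √P / (C * Q) * (c / (2 ^ (κ * n P) * (n P + 1))) / 2 =
        √P * (c / (2 * C * (((2 : ℝ) ^ n P) ^ (κ + 1) * (n P + 1)))) := by
      simp only [Q, Nat.cast_pow, Nat.cast_ofNat]
      have : (2 : ℝ) ^ (κ * n P) * 2 ^ n P = (2 ^ n P) ^ (κ + 1) := by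
        rw [← pow_add, ← pow_mul]; ring_nf
      rw [← this]
      field_simp
    rw [h5]
    calc D₀ = 2 * D₀ * C / c * (((2 : ℝ) ^ n P) ^ (κ + 1) * (n P + 1)) *
          (c / (2 * C * (((2 : ℝ) ^ n P) ^ (κ + 1) * (n P + 1)))) := by field_simp
      _ ≤ _ := by gcongr
  have hQne : Nonempty (Fin s → Fin Q × Fin Q) := ⟨fun _ => (⟨0, hQ⟩, ⟨0, hQ⟩)⟩
  have hrate := achievableRate_of_separated hpw hsep (L := L) (by omega) (hD₀ _ hD)
  refine hrate.mono ?_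
  have hcard : Real.logb 2 (Fintype.card (Fin s → Fin Q × Fin Q)) = 2 * s * n P := by
    simp only [Fintype.card_pi, Fintype.card_prod, Fintype.card_fin, Finset.prod_const,
      Finset.card_univ, Q]
    push_cast
    rw [← pow_add, ← pow_mul, Real.logb_pow, Real.logb_self_eq_one one_lt_two]
    push_cast
    ring
  rw [hcard]
  have e1 : (1 / (t : ℝ) - 3 / L) = G := by rw [hG]; ring
  rw [e1]
  have h6 : G * (2 * s * (β * Real.logb 2 P - 1)) ≤ G * (2 * s * n P) := by gcongr
  have h7 : (6 * s / (t * (1 + κ)) - η / 2) * Real.logb 2 P ≤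
      6 * (G * (2 * s * β)) * Real.logb 2 P := by gcongr
  have h8 : 12 * G * s + 12 ≤ η / 2 * Real.logb 2 P := by
    rw [div_le_iff₀ (by positivity)] at hPη
    linarith
  linarith

theorem one_le_norm_of_mem_gaussianBox {Q : ℕ} {z : ℂ} (hz : z ∈ gaussianBox Q) (h0 : z ≠ 0) :
    1 ≤ ‖z‖ := by
  obtain ⟨u, v, -, -, rfl⟩ := hz
  have h1 : ‖(u : ℂ) + v * Complex.I‖ ^ 2 = ((u ^ 2 + v ^ 2 : ℤ) : ℝ) := by
    have := Complex.sq_norm ((u : ℂ) + v * Complex.I)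
    rw [this, Complex.normSq_apply]
    simp; ring
  have h2 : 0 < u ^ 2 + v ^ 2 := by
    have h3 : ‖(u : ℂ) + v * Complex.I‖ ^ 2 ≠ 0 := by simpa using h0
    rw [h1] at h3
    have h4 : u ^ 2 + v ^ 2 ≠ 0 := by exact_mod_cast h3
    have := sq_nonneg u
    have := sq_nonneg v
    omega
  have h3 : (1 : ℝ) ≤ ‖(u : ℂ) + v * Complex.I‖ ^ 2 := by
    rw [h1]; exact_mod_cast h2
  exact (one_le_sq_iff₀ (norm_nonneg _)).1 h3

end Linear

/-- The degrees of freedom of a decodable linear scheme are achievable. -/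
theorem LinearScheme.Decodable.achievableDoF {M N s : ℕ} [NeZero N] {τ : Type} [Fintype τ]
    [DecidableEq τ] [Nonempty τ] {L : LinearScheme M N s τ} {H : Channel M N}
    (hL : L.Decodable H) : AchievableDoF H L.dof := by
  classical
  have : NeZero (Fintype.card τ) := ⟨Fintype.card_ne_zero⟩
  let e := Fintype.equivFin τ
  let V : RxGroup → Fin 3 → Matrix (Fin (Fintype.card τ) × Fin M) (Fin s) ℂ := fun S p =>
    (L.V S p).submatrix (fun i => (e.symm i.1, i.2)) id
  have hseen : ∀ j S p (i : τ × {n // n ∈ L.active j}) (v : Fin s → ℂ),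
      (precodedLink V H j S p).mulVec v (e i.1, i.2.1) = (L.seen H j S p).mulVec v i := by
    intro j S p i v
    simp [Matrix.mulVec, dotProduct, LinearScheme.seen_apply, precodedLink, V]
  have hU : ∀ j S p, ∃ U : Matrix (Fin s) (τ × {n // n ∈ L.active j}) ℂ, j ∈ S.1 →
      U * L.seen H j S p = 1 ∧
        ∀ S' p', (S', p') ≠ (S, p) → U * L.seen H j S' p' = 0 := by
    intro j S p
    by_cases hS : j ∈ S.1
    · obtain ⟨U, hU⟩ := hL j S hS p
      exact ⟨U, fun _ => hU⟩
    · exact ⟨0, fun h => absurd h hS⟩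
  choose U hU using hU
  let C : ℝ := ∑ j, ∑ S, ∑ p, ∑ c, ∑ i, ‖U j S p c i‖
  have hC : 0 ≤ C := by positivity
  -- The combining matrix maps a received difference to the Gaussian integers `Δ S p`, one of which
  -- has modulus at least one. The distance is thus bounded below uniformly in `Q`, so `κ = 0`; the
  -- factor `n + 1` only weakens the claim.
  have hmain : ∀ᶠ n : ℕ in atTop, MinDistGE V H (2 ^ n) (1 / (1 + C) / (2 ^ (0 * n) * (n + 1))) := by
    refine Filter.Eventually.of_forall fun n => ?_
    rintro j Δ hΔ ⟨S, p, hjS, hne⟩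
    obtain ⟨c, hc⟩ := Function.ne_iff.1 hne
    have hrec : ∑ i, U j S p c i * (∑ S', ∑ p', (L.seen H j S' p').mulVec (Δ S' p') i) =
        Δ S p c := by
      have h1 : ∀ S' p', ∑ i, U j S p c i * (L.seen H j S' p').mulVec (Δ S' p') i =
          if (S', p') = (S, p) then Δ S p c else 0 := by
        intro S' p'
        change (U j S p).mulVec ((L.seen H j S' p').mulVec (Δ S' p')) c = _
        rw [Matrix.mulVec_mulVec]
        split_ifs with h
        · obtain ⟨rfl, rfl⟩ := Prod.mk.inj h
          rw [(hU j S' p' hjS).1, Matrix.one_mulVec]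
        · rw [(hU j S p hjS).2 S' p' h, Matrix.zero_mulVec]; rfl
      simp only [Finset.mul_sum]
      rw [Finset.sum_comm]
      simp only [Finset.sum_comm (s := Finset.univ (α := τ × {n // n ∈ L.active j}))
        (t := Finset.univ (α := Fin 3)), h1]
      rw [← Fintype.sum_prod_type' (f := fun S' p' =>
        if (S', p') = (S, p) then Δ S p c else 0)]
      simp
    by_contra! hcon
    have hle : (1 / (1 + C)) / (2 ^ (0 * n) * ((n : ℝ) + 1)) ≤ 1 / (1 + C) := by
      refine div_le_self (by positivity) ?_
      simp
    have h1 : 1 ≤ ‖Δ S p c‖ := one_le_norm_of_mem_gaussianBox (hΔ S p c) hc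
    have h2 : ‖Δ S p c‖ ≤ ∑ i, ‖U j S p c i‖ * (1 / (1 + C)) := by
      rw [← hrec]
      refine norm_sum_le_of_le _ fun i _ => ?_
      rw [norm_mul]
      gcongr
      have := (hcon (e i.1, i.2.1)).le.trans hle
      simpa only [hseen] using this
    have h3 : ∑ i, ‖U j S p c i‖ ≤ C := by
      calc _ ≤ ∑ c, ∑ i, ‖U j S p c i‖ := Finset.single_le_sum
            (f := fun c => ∑ i, ‖U j S p c i‖) (fun _ _ => by positivity) (Finset.mem_univ c)
        _ ≤ ∑ p, ∑ c, ∑ i, ‖U j S p c i‖ := Finset.single_le_sum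
            (f := fun p => ∑ c, ∑ i, ‖U j S p c i‖) (fun _ _ => by positivity) (Finset.mem_univ p)
        _ ≤ ∑ S, ∑ p, ∑ c, ∑ i, ‖U j S p c i‖ := Finset.single_le_sum
            (f := fun S => ∑ p, ∑ c, ∑ i, ‖U j S p c i‖) (fun _ _ => by positivity)
            (Finset.mem_univ S)
        _ ≤ C := Finset.single_le_sum
            (f := fun j => ∑ S, ∑ p, ∑ c, ∑ i, ‖U j S p c i‖) (fun _ _ => by positivity)
            (Finset.mem_univ j)
    rw [← Finset.sum_mul, mul_one_div] at h2
    have h4 : (∑ i, ‖U j S p c i‖) / (1 + C) < 1 := by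
      rw [div_lt_one (by positivity)]; linarith
    linarith
  have := achievableDoF_of_minDistGE (by positivity) hmain
  simpa [LinearScheme.dof] using this

/-! ### Rational independence of almost all channels with single antennas -/

section Diophantine

/-- The Gaussian integer with given real and imaginary part. -/
def gaussianInt (q : ℤ × ℤ) : ℂ := q.1 + q.2 * Complex.I

theorem one_le_norm_gaussianInt {q : ℤ × ℤ} (h : q ≠ 0) : 1 ≤ ‖gaussianInt q‖ := by
  refine one_le_norm_of_mem_gaussianBox (Q := q.1.natAbs + q.2.natAbs + 1)
    ⟨q.1, q.2, by push_cast; have := abs_nonneg q.2; linarith,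
      by push_cast; have := abs_nonneg q.1; linarith, rfl⟩ fun h0 => h ?_
  have h1 := congrArg Complex.re h0
  have h2 := congrArg Complex.im h0
  simp [gaussianInt] at h1 h2
  exact Prod.ext h1 h2

/-- Two points of the set have values of `b / z` within `2 * r`, and inversion on the annulus
stretches distances by at most `R ^ 2 / ‖b‖`. So the set lies in a disc about any of its points. -/
theorem volume_small_linear_form_le {b c w : ℂ} {R r : ℝ} (hR : 0 < R) (hb : b ≠ 0) :
    volume {z : ℂ | (1 / R ≤ ‖z‖ ∧ ‖z‖ ≤ R) ∧ ‖w + c + b / z‖ < r} ≤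
      ENNReal.ofReal (2 * r * R ^ 2 / ‖b‖) ^ 2 * NNReal.pi := by
  rcases Set.eq_empty_or_nonempty {z : ℂ | (1 / R ≤ ‖z‖ ∧ ‖z‖ ≤ R) ∧ ‖w + c + b / z‖ < r}
    with h | ⟨z₀, ⟨hz₀1, hz₀2⟩, hz₀⟩
  · rw [h]; simp
  rw [← Complex.volume_closedBall]
  refine measure_mono ?_
  rintro z ⟨⟨hz1, hz2⟩, hz⟩
  have hz0 : z ≠ 0 := norm_pos_iff.1 (lt_of_lt_of_le (by positivity) hz1)
  have hz00 : z₀ ≠ 0 := norm_pos_iff.1 (lt_of_lt_of_le (by positivity) hz₀1)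
  have h1 : ‖b / z - b / z₀‖ ≤ 2 * r := by
    have : b / z - b / z₀ = (w + c + b / z) - (w + c + b / z₀) := by ring
    rw [this]
    refine (norm_sub_le _ _).trans ?_
    linarith
  have h2 : b / z - b / z₀ = b * (z₀ - z) / (z * z₀) := by field_simp
  have hbp : 0 < ‖b‖ := norm_pos_iff.2 hb
  have hzp : 0 < ‖z‖ := norm_pos_iff.2 hz0
  have hzp' : 0 < ‖z₀‖ := norm_pos_iff.2 hz00
  have hr : 0 < r := lt_of_le_of_lt (norm_nonneg _) hz
  rw [h2, norm_div, norm_mul, norm_mul, div_le_iff₀ (by positivity)] at h1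
  rw [Metric.mem_closedBall, dist_comm, dist_eq_norm, le_div_iff₀ hbp, mul_comm]
  calc ‖b‖ * ‖z₀ - z‖ ≤ 2 * r * (‖z‖ * ‖z₀‖) := h1
    _ ≤ 2 * r * (R * R) := by gcongr
    _ = 2 * r * R ^ 2 := by ring

theorem card_Icc_ceil_floor_le (x : ℝ) {ρ : ℝ} (hρ : 0 ≤ ρ) :
    ((Finset.Icc ⌈x - ρ⌉ ⌊x + ρ⌋).card : ℝ) ≤ 2 * ρ + 1 := by
  rw [Int.card_Icc]
  have h1 := Int.le_ceil (x - ρ)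
  have h2 := Int.floor_le (x + ρ)
  rcases le_total 0 (⌊x + ρ⌋ + 1 - ⌈x - ρ⌉) with h | h
  · have : (((⌊x + ρ⌋ + 1 - ⌈x - ρ⌉).toNat : ℤ) : ℝ) = ((⌊x + ρ⌋ + 1 - ⌈x - ρ⌉ : ℤ) : ℝ) := by
      rw [Int.toNat_of_nonneg h]
    rw [← Int.cast_natCast, this]
    push_cast
    linarith
  · rw [Int.toNat_of_nonpos h]
    simp; linarith

/-- The measure of the points at which an inverse linear form comes close to some Gaussian
integer. -/
theorem volume_exists_gaussianInt_le {a b c : ℂ} {R r : ℝ} (hR : 1 ≤ R) (hr : r ≤ 1)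
    (hb : 1 ≤ ‖b‖) (ha : 1 / R ≤ ‖a‖) (ha' : ‖a‖ ≤ R) :
    volume {z : ℂ | (1 / R ≤ ‖z‖ ∧ ‖z‖ ≤ R) ∧ ∃ w, ‖gaussianInt w + c + b * a / z‖ < r} ≤
      ENNReal.ofReal (144 * Real.pi * R ^ 10 * r ^ 2) := by
  have hR0 : 0 < R := by linarith
  have ha0 : 0 < ‖a‖ := lt_of_lt_of_le (by positivity) ha
  have hb0 : 0 < ‖b‖ := by linarith
  have hba : b * a ≠ 0 := mul_ne_zero (norm_pos_iff.1 hb0) (norm_pos_iff.1 ha0)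
  -- On the annulus `‖b * a / z‖ ≤ ‖b‖ * R ^ 2`, so only Gaussian integers within `ρ` of `-c` can
  -- matter; the factor 2 absorbs `r ≤ 1`.
  set ρ : ℝ := 2 * ‖b‖ * R ^ 2 with hρ
  have hR2 : 1 ≤ R ^ 2 := one_le_pow₀ hR
  have hρ1 : 2 ≤ ρ := by
    rw [hρ]; nlinarith
  let W := Finset.Icc ⌈(-c).re - ρ⌉ ⌊(-c).re + ρ⌋ ×ˢ Finset.Icc ⌈(-c).im - ρ⌉ ⌊(-c).im + ρ⌋
  have hW : (W.card : ℝ) ≤ (3 * ρ) ^ 2 := by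
    rw [Finset.card_product, sq]
    push_cast
    have h1 := card_Icc_ceil_floor_le (-c).re (show 0 ≤ ρ by linarith)
    have h2 := card_Icc_ceil_floor_le (-c).im (show 0 ≤ ρ by linarith)
    exact mul_le_mul (by linarith) (by linarith) (by positivity) (by linarith)
  have hsub : {z : ℂ | (1 / R ≤ ‖z‖ ∧ ‖z‖ ≤ R) ∧ ∃ w, ‖gaussianInt w + c + b * a / z‖ < r} ⊆
      ⋃ w ∈ W, {z : ℂ | (1 / R ≤ ‖z‖ ∧ ‖z‖ ≤ R) ∧ ‖gaussianInt w + c + b * a / z‖ < r} := by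
    rintro z ⟨⟨hz1, hz2⟩, w, hw⟩
    simp only [Set.mem_iUnion]
    refine ⟨w, ?_, ⟨hz1, hz2⟩, hw⟩
    have hzp : 0 < ‖z‖ := lt_of_lt_of_le (by positivity) hz1
    have h1 : ‖b * a / z‖ ≤ ‖b‖ * R ^ 2 := by
      rw [norm_div, norm_mul, div_le_iff₀ hzp]
      calc ‖b‖ * ‖a‖ ≤ ‖b‖ * R := by gcongr
        _ = ‖b‖ * R ^ 2 * (1 / R) := by field_simp
        _ ≤ ‖b‖ * R ^ 2 * ‖z‖ := by gcongr
    have h2 : ‖gaussianInt w - -c‖ ≤ ρ := by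
      have : gaussianInt w - -c = (gaussianInt w + c + b * a / z) - b * a / z := by ring
      rw [this]
      refine (norm_sub_le _ _).trans ?_
      have : 1 ≤ ‖b‖ * R ^ 2 := by nlinarith
      rw [hρ]; linarith
    have h3 := (Complex.abs_re_le_norm _).trans h2
    have h4 := (Complex.abs_im_le_norm _).trans h2
    have e1 : (gaussianInt w).re = w.1 := by simp [gaussianInt]
    have e2 : (gaussianInt w).im = w.2 := by simp [gaussianInt]
    rw [Complex.sub_re, e1, abs_le] at h3
    rw [Complex.sub_im, e2, abs_le] at h4
    refine Finset.mem_product.2 ⟨Finset.mem_Icc.2 ⟨Int.ceil_le.2 ?_, Int.le_floor.2 ?_⟩,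
      Finset.mem_Icc.2 ⟨Int.ceil_le.2 ?_, Int.le_floor.2 ?_⟩⟩ <;> linarith
  rcases le_or_gt r 0 with hr0 | hr0
  · have : {z : ℂ | (1 / R ≤ ‖z‖ ∧ ‖z‖ ≤ R) ∧ ∃ w, ‖gaussianInt w + c + b * a / z‖ < r} = ∅ := by
      refine Set.eq_empty_of_forall_notMem ?_
      rintro z ⟨-, w, hw⟩
      exact absurd (lt_of_le_of_lt (norm_nonneg _) hw) (not_lt.2 hr0)
    rw [this]; simp
  -- The number of Gaussian integers grows like `‖b‖ ^ 2` while each disc has area of order `‖b‖ ^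
  -- (-2)`, so the bound is uniform in `b`.
  calc volume _ ≤ volume _ := measure_mono hsub
    _ ≤ ∑ w ∈ W, volume {z : ℂ | (1 / R ≤ ‖z‖ ∧ ‖z‖ ≤ R) ∧
          ‖gaussianInt w + c + b * a / z‖ < r} := measure_biUnion_finset_le _ _
    _ ≤ ∑ w ∈ W, ENNReal.ofReal (2 * r * R ^ 2 / ‖b * a‖) ^ 2 * NNReal.pi :=
        Finset.sum_le_sum fun w _ => volume_small_linear_form_le hR0 hba
    _ = ENNReal.ofReal (W.card * ((2 * r * R ^ 2 / ‖b * a‖) ^ 2 * Real.pi)) := by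
        rw [Finset.sum_const, nsmul_eq_mul, ENNReal.ofReal_mul (by positivity),
          ENNReal.ofReal_mul (by positivity), ENNReal.ofReal_natCast,
          ENNReal.ofReal_pow (by positivity)]
        congr 2
        rw [← NNReal.coe_real_pi, ENNReal.ofReal_coe_nnreal]
    _ ≤ _ := by
        refine ENNReal.ofReal_le_ofReal ?_
        have h1 : 2 * r * R ^ 2 / ‖b * a‖ ≤ 2 * r * R ^ 3 / ‖b‖ := by
          rw [norm_mul, div_le_div_iff₀ (by positivity) hb0]
          calc 2 * r * R ^ 2 * ‖b‖ = 2 * r * R ^ 3 * (‖b‖ * (1 / R)) := by field_simp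
            _ ≤ 2 * r * R ^ 3 * (‖b‖ * ‖a‖) := by gcongr
        calc (W.card : ℝ) * ((2 * r * R ^ 2 / ‖b * a‖) ^ 2 * Real.pi)
            ≤ (3 * ρ) ^ 2 * ((2 * r * R ^ 3 / ‖b‖) ^ 2 * Real.pi) := by
              have := Real.pi_pos
              gcongr
          _ = 144 * Real.pi * R ^ 10 * r ^ 2 := by
              rw [hρ]; field_simp; ring

end Diophantine

/-! ### Single antennas: Borel–Cantelli and arithmetic alignment. -/

section SingleAntenna

/-- The indices of the messages that receiver `k` desires, by the excluded receiver. -/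
abbrev DesiredIndex (k : Fin 3) : Type := {j : Fin 3 // j ≠ k} × Fin 3

/-- The desired part of the signal of receiver `k` when every transmitter inverts the channel to the
excluded receiver. -/
def desiredForm (k : Fin 3) (q : DesiredIndex k → ℤ × ℤ) (H : Channel 1 1) : ℂ :=
  ∑ x, gaussianInt (q x) * (H (k, x.2, 0, 0) / H (x.1.1, x.2, 0, 0))

/-- The channels for which the desired signal comes close to a Gaussian integer. -/
def nearGaussianInt (k : Fin 3) (q : DesiredIndex k → ℤ × ℤ) (r : ℝ) : Set (Channel 1 1) :=
  {H | ∃ w, ‖gaussianInt w + desiredForm k q H‖ < r}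

theorem measurableSet_nearGaussianInt (k : Fin 3) (q : DesiredIndex k → ℤ × ℤ) (r : ℝ) :
    MeasurableSet (nearGaussianInt k q r) := by
  have hm : Measurable (desiredForm k q) := by
    unfold desiredForm
    fun_prop
  have : nearGaussianInt k q r = ⋃ w, {H | ‖gaussianInt w + desiredForm k q H‖ < r} := by
    ext H; simp [nearGaussianInt]
  rw [this]
  exact MeasurableSet.iUnion fun w => measurableSet_lt (hm.const_add _).norm measurable_const

/-- The channels whose coefficients have bounded absolute value, inverse and density. -/
def boundedRegion (f : ℂ → ENNReal) (R : ℝ) : Set (Channel 1 1) :=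
  {H | ∀ i, (1 / R ≤ ‖H i‖ ∧ ‖H i‖ ≤ R) ∧ f (H i) ≤ ENNReal.ofReal R}

theorem measurableSet_boundedRegion {f : ℂ → ENNReal} (hf : Measurable f) (R : ℝ) :
    MeasurableSet (boundedRegion f R) := by
  have : boundedRegion f R =
      ⋂ i, {H | (1 / R ≤ ‖H i‖ ∧ ‖H i‖ ≤ R) ∧ f (H i) ≤ ENNReal.ofReal R} := by
    ext H; simp [boundedRegion]
  rw [this]
  refine MeasurableSet.iInter fun i => ?_
  have hi : Measurable fun H : Channel 1 1 => H i := measurable_pi_apply i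
  exact ((measurableSet_le measurable_const hi.norm).inter
    (measurableSet_le hi.norm measurable_const)).inter
    (measurableSet_le (hf.comp hi) measurable_const)

theorem measure_le_mul_volume {ν : Measure ℂ} [IsFiniteMeasure ν] (hac : ν ≪ volume) {c : ENNReal}
    {s : Set ℂ} (hs : ∀ z ∈ s, ν.rnDeriv volume z ≤ c) : ν s ≤ c * volume s := by
  conv_lhs => rw [← Measure.withDensity_rnDeriv_eq ν volume hac]
  rw [withDensity_apply' _ s]
  exact (setLIntegral_mono measurable_const hs).trans (by simp)

/-- Only the denominator belonging to a nonzero coefficient `q x₀` is varied. It occurs in no other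
term, so the form is a constant plus a multiple of `1 / z`, and the planar estimate applies; the
bound on the density contributes one more factor `R`. -/
theorem channelLaw_nearGaussianInt_le {ν : Measure ℂ} [IsProbabilityMeasure ν] (hac : ν ≪ volume)
    {R r : ℝ} (hR : 1 ≤ R) (hr : r ≤ 1) (k : Fin 3) {q : DesiredIndex k → ℤ × ℤ} (hq : q ≠ 0) :
    channelLaw 1 1 ν (nearGaussianInt k q r ∩ boundedRegion (ν.rnDeriv volume) R) ≤
      ENNReal.ofReal (144 * Real.pi * R ^ 11 * r ^ 2) := by
  obtain ⟨x₀, hx₀⟩ := Function.ne_iff.1 hq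
  refine pi_measure_le_of_section ν ((measurableSet_nearGaussianInt k q r).inter
    (measurableSet_boundedRegion (Measure.measurable_rnDeriv _ _) R)) (x₀.1.1, x₀.2, 0, 0)
    fun H => ?_
  set i₀ : Fin 3 × Fin 3 × Fin 1 × Fin 1 := (x₀.1.1, x₀.2, 0, 0) with hi₀
  set a : ℂ := H (k, x₀.2, 0, 0) with ha
  set c : ℂ := ∑ x ∈ Finset.univ.erase x₀,
    gaussianInt (q x) * (H (k, x.2, 0, 0) / H (x.1.1, x.2, 0, 0)) with hc
  have hform : ∀ z, desiredForm k q (Function.update H i₀ z) =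
      c + gaussianInt (q x₀) * a / z := by
    intro z
    have hk : ∀ p, Function.update H i₀ z (k, p, 0, 0) = H (k, p, 0, 0) := fun p =>
      Function.update_of_ne (fun h => x₀.1.2 (Prod.mk.inj h).1.symm) _ _
    rw [desiredForm, ← Finset.sum_erase_add _ _ (Finset.mem_univ x₀)]
    congr 1
    · refine Finset.sum_congr rfl fun x hx => ?_
      rw [hk, Function.update_of_ne]
      intro h
      simp only [hi₀, Prod.mk.injEq, and_true] at h
      exact (Finset.ne_of_mem_erase hx) (Prod.ext (Subtype.ext h.1) h.2)
    · rw [hk, ← hi₀, Function.update_self, ha, mul_div_assoc]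
  have hsub : {z | Function.update H i₀ z ∈ nearGaussianInt k q r ∩
      boundedRegion (ν.rnDeriv volume) R} ⊆
      {z | ((1 / R ≤ ‖z‖ ∧ ‖z‖ ≤ R) ∧ ∃ w, ‖gaussianInt w + c + gaussianInt (q x₀) * a / z‖ < r) ∧
        ν.rnDeriv volume z ≤ ENNReal.ofReal R ∧ 1 / R ≤ ‖a‖ ∧ ‖a‖ ≤ R} := by
    rintro z ⟨⟨w, hw⟩, hz⟩
    have h1 := hz i₀
    have h2 := hz (k, x₀.2, 0, 0)
    rw [Function.update_self] at h1
    rw [Function.update_of_ne (fun h => x₀.1.2 (Prod.mk.inj h).1.symm)] at h2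
    refine ⟨⟨h1.1, w, ?_⟩, h1.2, h2.1⟩
    rwa [hform, ← add_assoc] at hw
  refine (measure_mono hsub).trans ?_
  by_cases hab : 1 / R ≤ ‖a‖ ∧ ‖a‖ ≤ R
  · refine (measure_le_mul_volume hac fun z hz => hz.2.1).trans ?_
    calc _ ≤ ENNReal.ofReal R * ENNReal.ofReal (144 * Real.pi * R ^ 10 * r ^ 2) := by
          gcongr
          exact (measure_mono fun z hz => hz.1).trans (volume_exists_gaussianInt_le hR hr
            (one_le_norm_gaussianInt hx₀) hab.1 hab.2)
      _ = _ := by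
          rw [← ENNReal.ofReal_mul (by linarith)]
          ring_nf
  · refine le_trans (measure_mono (t := ∅) fun z hz => hab hz.2.2) ?_
    simp

/-- Pairs of integers less than `Q` in absolute value. -/
def intBox (Q : ℕ) : Finset (ℤ × ℤ) :=
  Finset.Ioo (-Q : ℤ) Q ×ˢ Finset.Ioo (-Q : ℤ) Q

theorem card_intBox_le (Q : ℕ) : (intBox Q).card ≤ (2 * Q) ^ 2 := by
  rw [intBox, Finset.card_product, Int.card_Ioo, sq]
  have : ((Q : ℤ) - -Q - 1).toNat ≤ 2 * Q := by omega
  exact Nat.mul_le_mul this this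

theorem card_desiredIndex (k : Fin 3) : Fintype.card (DesiredIndex k) = 6 := by
  rw [Fintype.card_prod, Fintype.card_subtype_compl]
  simp

/-- For almost every channel the combinations of the coefficients of the desired symbols by integers
of size `Q` keep a distance of order `1 / Q ^ 6` from the Gaussian integers. -/
theorem ae_eventually_notMem_nearGaussianInt (k : Fin 3) :
    ForAlmostEveryChannel 1 1 fun H => ∀ᶠ n : ℕ in atTop, ∀ q : DesiredIndex k → ℤ × ℤ,
      (∀ x, q x ∈ intBox (2 ^ n)) → q ≠ 0 →
        H ∉ nearGaussianInt k q (1 / (2 ^ (6 * n) * (n + 1))) := by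
  classical
  intro ν hν hac
  -- There are at most about `2 ^ (12 * n)` vectors `q`, each bad with probability of order `r n ^
  -- 2`. The factor `n + 1` makes the sum over `n` converge.
  let r : ℕ → ℝ := fun n => 1 / (2 ^ (6 * n) * (n + 1))
  let box : ℕ → Finset (DesiredIndex k → ℤ × ℤ) := fun n =>
    (Fintype.piFinset fun _ => intBox (2 ^ n)).erase 0
  let bad : ℕ → ℕ → Set (Channel 1 1) := fun R n => ⋃ q ∈ box n, (nearGaussianInt k q (r n) ∩
    boundedRegion (ν.rnDeriv volume) (R + 1))
  have hr : ∀ n, r n ≤ 1 := fun n => by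
    refine (div_le_one (by positivity)).2 ?_
    exact one_le_mul_of_one_le_of_one_le (one_le_pow₀ one_le_two) (by simp)
  have hbox : ∀ n, ((box n).card : ℝ) ≤ 2 ^ 12 * (2 ^ (6 * n)) ^ 2 := by
    intro n
    have h1 : (box n).card ≤ ((2 * 2 ^ n) ^ 2) ^ 6 := by
      refine (Finset.card_erase_le).trans ?_
      rw [Fintype.card_piFinset, Finset.prod_const, Finset.card_univ, card_desiredIndex]
      exact Nat.pow_le_pow_left (card_intBox_le _) 6
    calc ((box n).card : ℝ) ≤ (((2 * 2 ^ n) ^ 2) ^ 6 : ℕ) := by exact_mod_cast h1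
      _ = 2 ^ 12 * (2 ^ (6 * n)) ^ 2 := by push_cast; rw [mul_pow, mul_pow]; ring
  have hbad : ∀ R n, channelLaw 1 1 ν (bad R n) ≤
      ENNReal.ofReal (2 ^ 12 * (144 * Real.pi * ((R : ℝ) + 1) ^ 11) * (1 / ((n : ℝ) + 1) ^ 2)) := by
    intro R n
    calc _ ≤ ∑ q ∈ box n, channelLaw 1 1 ν (nearGaussianInt k q (r n) ∩
          boundedRegion (ν.rnDeriv volume) (R + 1)) := measure_biUnion_finset_le _ _
      _ ≤ ∑ q ∈ box n, ENNReal.ofReal (144 * Real.pi * ((R : ℝ) + 1) ^ 11 * r n ^ 2) :=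
          Finset.sum_le_sum fun q hq => channelLaw_nearGaussianInt_le hac (by simp) (hr n) k
            (Finset.ne_of_mem_erase hq)
      _ = ENNReal.ofReal ((box n).card * (144 * Real.pi * ((R : ℝ) + 1) ^ 11 * r n ^ 2)) := by
          rw [Finset.sum_const, nsmul_eq_mul, ENNReal.ofReal_mul (Nat.cast_nonneg _),
            ENNReal.ofReal_natCast]
      _ ≤ _ := by
          refine ENNReal.ofReal_le_ofReal ?_
          have := Real.pi_pos
          calc ((box n).card : ℝ) * (144 * Real.pi * ((R : ℝ) + 1) ^ 11 * r n ^ 2)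
              ≤ 2 ^ 12 * (2 ^ (6 * n)) ^ 2 * (144 * Real.pi * ((R : ℝ) + 1) ^ 11 * r n ^ 2) := by
                gcongr
                exact hbox n
            _ = _ := by simp only [r]; field_simp
  have hsum : ∀ R : ℕ, ∑' n, channelLaw 1 1 ν (bad R n) ≠ ⊤ := by
    intro R
    have hs : Summable fun n : ℕ =>
        2 ^ 12 * (144 * Real.pi * ((R : ℝ) + 1) ^ 11) * (1 / ((n : ℝ) + 1) ^ 2) := by
      refine Summable.mul_left _ ?_
      have := (summable_nat_add_iff 1).2 (Real.summable_one_div_nat_pow.2 one_lt_two)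
      simpa using this
    exact ne_top_of_le_ne_top hs.tsum_ofReal_ne_top (ENNReal.tsum_le_tsum (hbad R))
  have hae : ∀ᵐ H ∂(channelLaw 1 1 ν), ∀ R : ℕ, ∀ᶠ n in atTop, H ∉ bad R n :=
    ae_all_iff.2 fun R => ae_eventually_notMem (hsum R)
  have hreg : ∀ᵐ H ∂(channelLaw 1 1 ν), ∀ i, H i ≠ 0 ∧ ν.rnDeriv volume (H i) < ⊤ := by
    refine ae_all_iff.2 fun i => ?_
    have h1 : ∀ᵐ z ∂ν, z ≠ 0 := hac.ae_le (Measure.ae_ne volume 0)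
    have h2 : ∀ᵐ z ∂ν, ν.rnDeriv volume z < ⊤ := hac.ae_le (Measure.rnDeriv_lt_top ν volume)
    exact (Measure.quasiMeasurePreserving_eval (μ := fun _ => ν) i).ae (h1.and h2)
  filter_upwards [hae, hreg] with H hH hHreg
  -- The bounded regions exhaust almost every channel, so a countable family of Borel–Cantelli
  -- statements suffices although the density need not be bounded.
  obtain ⟨R, hR⟩ : ∃ R : ℕ, H ∈ boundedRegion (ν.rnDeriv volume) (R + 1) := by
    have hi : ∀ i, ∀ᶠ R : ℕ in atTop, (1 / ((R : ℝ) + 1) ≤ ‖H i‖ ∧ ‖H i‖ ≤ R + 1) ∧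
        ν.rnDeriv volume (H i) ≤ ENNReal.ofReal (R + 1) := by
      intro i
      have h1 : ∀ᶠ R : ℕ in atTop, 1 / ((R : ℝ) + 1) ≤ ‖H i‖ :=
        tendsto_one_div_add_atTop_nhds_zero_nat.eventually_le_const
          (norm_pos_iff.2 (hHreg i).1)
      have h2 := tendsto_natCast_atTop_atTop.eventually_ge_atTop ‖H i‖
      have h3 := tendsto_natCast_atTop_atTop.eventually_ge_atTop
        (ν.rnDeriv volume (H i)).toReal
      filter_upwards [h1, h2, h3] with R h1 h2 h3
      exact ⟨⟨h1, by linarith⟩, ENNReal.le_ofReal_iff_toReal_le (hHreg i).2.ne (by positivity)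
        |>.2 (by linarith)⟩
    exact (eventually_all.2 hi).exists
  filter_upwards [hH R] with n hn q hq hq0 hmem
  refine hn ?_
  simp only [bad, Set.mem_iUnion]
  exact ⟨q, Finset.mem_erase.2 ⟨hq0, Fintype.mem_piFinset.2 hq⟩, hmem, hR⟩

/-- The receive groups, by the excluded receiver. -/
def groupEquiv : Fin 3 ≃ RxGroup :=
  Equiv.ofBijective groupExcluding ⟨groupExcluding_injective, fun S => by
    obtain ⟨j, hj⟩ := exists_eq_groupExcluding S
    exact ⟨j, hj.symm⟩⟩

/-- Every transmitter inverts the channel to the excluded receiver. -/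
def inversionPrecoder (H : Channel 1 1) (S : RxGroup) (p : Fin 3) :
    Matrix (Fin 1 × Fin 1) (Fin 1) ℂ :=
  Matrix.of fun _ _ => (H (excluded S, p, 0, 0))⁻¹

/-- Undesired symbols arrive with coefficient one, so their sum is a single Gaussian integer. Its
size is irrelevant because `nearGaussianInt` ranges over all Gaussian integers. -/
theorem minDistGE_inversionPrecoder {H : Channel 1 1} (h0 : ∀ i, H i ≠ 0) {Q : ℕ} {r : ℝ}
    (h : ∀ k, ∀ q : DesiredIndex k → ℤ × ℤ, (∀ x, q x ∈ intBox Q) → q ≠ 0 →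
      H ∉ nearGaussianInt k q r) : MinDistGE (inversionPrecoder H) H Q r := by
  classical
  rintro k Δ hΔ ⟨S, p, hkS, hne⟩
  choose u v hu hv huv using hΔ
  have hΔ' : ∀ S p c, Δ S p c = gaussianInt (u S p c, v S p c) := huv
  let q : DesiredIndex k → ℤ × ℤ := fun x =>
    (u (groupExcluding x.1.1) x.2 0, v (groupExcluding x.1.1) x.2 0)
  have hq : ∀ x, q x ∈ intBox Q := fun x => by
    have h1 := abs_lt.1 (hu (groupExcluding x.1.1) x.2 0)
    have h2 := abs_lt.1 (hv (groupExcluding x.1.1) x.2 0)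
    simp only [intBox, Finset.mem_product, Finset.mem_Ioo, q]
    exact ⟨h1, h2⟩
  have hq0 : q ≠ 0 := by
    intro hq0
    obtain ⟨j, rfl⟩ := exists_eq_groupExcluding S
    have h1 := congrFun hq0 (⟨j, (mem_groupExcluding.1 hkS).symm⟩, p)
    apply hne
    ext c
    rw [Subsingleton.elim c 0, hΔ']
    simp only [q, Pi.zero_apply] at h1
    rw [h1]
    simp [gaussianInt]
  have hdist := h k q hq hq0
  simp only [nearGaussianInt, Set.mem_ofPred_eq, not_exists, not_lt] at hdist
  refine ⟨(0, 0), ?_⟩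
  let w : ℤ × ℤ := (∑ p, u (groupExcluding k) p 0, ∑ p, v (groupExcluding k) p 0)
  refine (hdist w).trans (le_of_eq (congrArg norm ?_))
  symm
  have hterm : ∀ j p, (precodedLink (inversionPrecoder H) H k (groupExcluding j) p).mulVec
      (Δ (groupExcluding j) p) (0, 0) = gaussianInt (u (groupExcluding j) p 0,
        v (groupExcluding j) p 0) * (H (k, p, 0, 0) / H (j, p, 0, 0)) := by
    intro j p
    simp [Matrix.mulVec, dotProduct, precodedLink, inversionPrecoder, hΔ', div_eq_mul_inv]
    ring
  rw [← groupEquiv.sum_comp]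
  change ∑ j, ∑ p, (precodedLink (inversionPrecoder H) H k (groupExcluding j) p).mulVec
      (Δ (groupExcluding j) p) (0, 0) = _
  simp only [hterm]
  rw [← Finset.add_sum_erase _ _ (Finset.mem_univ k)]
  congr 1
  · simp only [div_self (h0 _), mul_one, gaussianInt, w]
    rw [Finset.sum_add_distrib, ← Finset.sum_mul]
    push_cast
    rfl
  · rw [desiredForm, Fintype.sum_prod_type]
    rw [Finset.sum_subtype (p := fun j => j ≠ k) (Finset.univ.erase k) (by simp)]

/-- Six sevenths of a degree of freedom per user are achievable with single antennas. -/
theorem achievableDoF_single_antenna :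
    ForAlmostEveryChannel 1 1 fun H => AchievableDoF H (6 / 7) := by
  have hne : ForAlmostEveryChannel 1 1 fun H => ∀ i, H i ≠ 0 :=
    ForAlmostEveryChannel.all fun i =>
      forAlmostEveryChannel_ne_zero (PolyFun.coord i) (fun _ => 1) one_ne_zero
  refine (hne.and (ForAlmostEveryChannel.all ae_eventually_notMem_nearGaussianInt)).mono ?_
  rintro H ⟨h0, hH⟩
  have h := achievableDoF_of_minDistGE (V := inversionPrecoder H) (H := H) (κ := 6) one_pos ?_
  · norm_num at h
    exact h
  · filter_upwards [eventually_all.2 hH] with n hn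
    exact minDistGE_inversionPrecoder h0 hn

end SingleAntenna

/-! ### Degrees of freedom for all numbers of antennas -/

theorem exists_aligned_scheme_d11 {M N : ℕ} (hM : 0 < M) (hN : 0 < N)
    (h : (N : ℝ) / M ≤ 9 / 7) (h1 : ¬ (M = 1 ∧ N = 1)) :
    ∃ s, ForAlmostEveryChannel M N fun H => ∃ L : LinearScheme M N s (Fin 7),
      L.Decodable H ∧ L.Aligned H ∧ L.dof = d11 M N := by
  have hM' : (0 : ℝ) < M := by exact_mod_cast hM
  have hd : d11 M N = 6 * (min M N : ℕ) / 7 := by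
    unfold d11
    by_cases hle : (N : ℝ) / M ≤ 1
    · rw [if_pos hle, min_eq_right]
      rw [div_le_one hM'] at hle
      exact_mod_cast hle
    · rw [if_neg hle, if_pos h, min_eq_left]
      rw [div_le_one hM'] at hle
      exact_mod_cast (not_le.1 hle).le
  rw [hd]
  rcases Nat.lt_or_ge (min M N) 2 with hK | hK
  · have hle : 7 * N ≤ 9 * M := by
      rw [div_le_div_iff₀ hM' (by norm_num)] at h
      have : (7 * N : ℝ) ≤ 9 * M := by linarith
      exact_mod_cast this
    -- If `M = 1`, then `7 * N ≤ 9` forces `N = 1`, the excluded case; hence the minimum is attained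
    -- by `N = 1` with `M ≥ 2`.
    obtain rfl : N = 1 := by omega
    obtain ⟨m, rfl⟩ : ∃ m, M = m + 2 := ⟨M - 2, by omega⟩
    refine ⟨1, ?_⟩
    have : min (m + 2) 1 = 1 := by omega
    rw [this]
    exact exists_aligned_scheme_single_receive_antenna
  · exact ⟨_, exists_aligned_scheme hK (min_le_left _ _) (min_le_right _ _)⟩

/-- The last two cases of `d11` combine to `2 * K / 3` with `K = min (3 * M) N`, the number of
streams a receiver can resolve in one slot. -/
theorem exists_alternating_scheme_d11 {M N : ℕ} (hM : 0 < M) (h : 9 / 7 < (N : ℝ) / M) :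
    ∃ s, ForAlmostEveryChannel M N fun H => ∃ L : LinearScheme M N s (Fin 3 × Fin 3),
      L.Decodable H ∧ L.Alternating ∧ L.dof = d11 M N := by
  have hM' : (0 : ℝ) < M := by exact_mod_cast hM
  have hd : d11 M N = 2 * (min (3 * M) N : ℕ) / 3 := by
    unfold d11
    rw [if_neg (by linarith), if_neg (by linarith)]
    by_cases hle : (N : ℝ) / M ≤ 3
    · rw [if_pos hle, min_eq_right]
      rw [div_le_iff₀ hM'] at hle
      exact_mod_cast hle
    · rw [if_neg hle, min_eq_left]
      · push_cast; ring
      · rw [div_le_iff₀ hM'] at hle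
        exact_mod_cast (not_le.1 hle).le
  rw [hd]
  exact ⟨_, exists_alternating_scheme (min_le_left _ _) (min_le_right _ _)⟩

theorem achievableDoF_d11 {M N : ℕ} (hM : 0 < M) (hN : 0 < N) :
    ForAlmostEveryChannel M N fun H => AchievableDoF H (d11 M N) := by
  have : NeZero N := ⟨hN.ne'⟩
  by_cases h1 : M = 1 ∧ N = 1
  · obtain ⟨rfl, rfl⟩ := h1
    have : d11 1 1 = 6 / 7 := by simp [d11]
    rw [this]
    exact achievableDoF_single_antenna
  · rcases le_or_gt ((N : ℝ) / M) (9 / 7) with h | h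
    · obtain ⟨s, hs⟩ := exists_aligned_scheme_d11 hM hN h h1
      refine hs.mono fun H ⟨L, hL, _, hd⟩ => ?_
      rw [← hd]
      exact hL.achievableDoF
    · obtain ⟨s, hs⟩ := exists_alternating_scheme_d11 hM h
      refine hs.mono fun H ⟨L, hL, _, hd⟩ => ?_
      rw [← hd]
      exact hL.achievableDoF

end XMulticast

end

theorem lemma2 (M N : ℕ) (hM : 0 < M) (hN : 0 < N) :
    XMulticast.ForAlmostEveryChannel M N
      (fun H => XMulticast.AchievableDoF H (XMulticast.d11 M N)) ∧
    ((N : ℝ) / (M : ℝ) ≤ 9 / 7 → ¬ (M = 1 ∧ N = 1) →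
      ∃ s t : ℕ, XMulticast.ForAlmostEveryChannel M N fun H =>
        ∃ L : XMulticast.LinearScheme M N s (Fin t),
          L.Decodable H ∧ L.Aligned H ∧ L.dof = XMulticast.d11 M N) ∧
    (9 / 7 < (N : ℝ) / (M : ℝ) →
      ∃ s l : ℕ, XMulticast.ForAlmostEveryChannel M N fun H =>
        ∃ L : XMulticast.LinearScheme M N s (Fin 3 × Fin l),
          L.Decodable H ∧ L.Alternating ∧ L.dof = XMulticast.d11 M N) := by
  exact ⟨XMulticast.achievableDoF_d11 hM hN,
    fun h h1 => (XMulticast.exists_aligned_scheme_d11 hM hN h h1).imp fun _ hs => ⟨7, hs⟩,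
    fun h => (XMulticast.exists_alternating_scheme_d11 hM h).imp fun _ hs => ⟨3, hs⟩⟩
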